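/- Let $p$ be a prime, let $E$ be a finite extension of $\mathbb{Q}_p$ with the absolute value extending the one of $\mathbb{Q}_p$, and let $A=E\langle x_1,\dots,x_d\rangle$ ($d\ge 0$) be a Tate algebra over $E$. Let $K$ be a finite extension of $\mathbb{Q}_p$, let $\Gamma_K^0\cong\mathbb{Z}_p$ be its cyclotomic group with a fixed topological generator $\gamma_K$, and write $T=\gamma_K-1$. For $i\ge 0$ put $\rho_i=p^{-1/(p^i(p-1))}$, let $\mathcal{H}_i(\Gamma_K^0)$ be the $\mathbb{Q}_p$-algebra of rigid analytic functions of $T$ on the closed disc $|T|\le\rho_i$, and let $$\mathcal{H}_{A,i}=A\,\widehat\otimes_{\mathbb{Q}_p}\mathcal{H}_i(\Gamma_K^0)=\Big\{\sum_{j,I}c_{j,I}T^jx^I\in E[[T,x_1,\dots,x_d]] : |c_{j,I}|\,\rho_i^{\,j}\to 0 \text{ as } j+|I|\to\infty\Big\},$$ $$\mathcal{H}_A=\mathcal{H}_A(\Gamma_K^0)=\varprojlim_i\mathcal{H}_{A,i}=\bigcap_i\mathcal{H}_{A,i}.$$ Let $M$ be a torsion coadmissible $\mathcal{H}_A$-module: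 $M=\varprojlim_i M_i$, where each $M_i$ is a finitely generated $\mathcal{H}_{A,i}$-module and the transition maps $M_{i+1}\to M_i$ induce isomorphisms $\mathcal{H}_{A,i}\otimes_{\mathcal{H}_{A,i+1}}M_{i+1}\cong M_i$. Suppose that there is an exact sequence $$0\to P_1\xrightarrow{\ \varphi\ }P_0\to M\to 0$$ of $\mathcal{H}_A$-modules with $P_0,P_1$ free of finite rank. Then $P_0$ and $P_1$ have the same rank, say $n$. Let $\det_{\mathcal{H}_A}(M)\subseteq\mathcal{H}_A$ be the ideal generated by $\bigwedge^n\varphi\in\operatorname{Hom}(\bigwedge^nP_1,\bigwedge^nP_0)=\det(P_1)^{-1}\otimes\det(P_0)\cong\mathcal{H}_A$, that is, by the determinant of the matrix of $\varphi$ in any bases. For a finitely generated torsion $\mathcal{H}_{A,i}$-module $N$ let $$\operatorname{char}_{\mathcal{H}_{A,i}}(N)=\prod_{\operatorname{ht}\mathfrak{p}=1}\mathfrak{p}^{e_{\mathfrak{p}}},\qquad e_{\mathfrak p}=\sum_{t\ge1}t\,n(\mathfrak p,t)=\operatorname{length}_{(\mathcal{H}_{A,i})_{\mathfrak p}}N_{\mathfrak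 p},$$ where $N$ is pseudo-isomorphic to $\bigoplus_{\mathfrak p,t}(\mathcal{H}_{A,i}/\mathfrak p^t)^{n(\mathfrak p,t)}$, and let the cylindrical characteristic ideal of $M$ be $$\operatorname{char}_{\mathcal{H}_A}(M)=\varprojlim_i\operatorname{char}_{\mathcal{H}_{A,i}}(M_i)\subseteq\mathcal{H}_A .$$ Then $$\det\nolimits_{\mathcal{H}_A}(M)=\operatorname{char}_{\mathcal{H}_A}(M).$$ -/

import Mathlib

open scoped TensorProduct

noncomputable section

/-! ### Characteristic ideals of torsion modules -/

namespace CylChar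

section Char

variable (R : Type*) [CommRing R] (M : Type*) [AddCommGroup M] [Module R M]

/-- The prime ideals of height one. -/
abbrev HeightOnePrime : Type _ := {𝔭 : PrimeSpectrum R // 𝔭.asIdeal.height = 1}

variable {R}

/-- The exponent `e_𝔭` of a height-one prime `𝔭` in the characteristic ideal of `M`: the length of
the localised module `M_𝔭` over the local ring `R_𝔭`. If `M` is pseudo-isomorphic to
`⨁_𝔭 ⨁_{t ≥ 1} (R/𝔭^t)^{n(𝔭,t)}`, then `e_𝔭 = ∑_t t * n(𝔭,t)`; see
`charExponent_eq_sum_of_pseudoIso`. -/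
def charExponent (𝔭 : HeightOnePrime R) : ℕ :=
  (Module.length (Localization.AtPrime 𝔭.1.asIdeal)
    (LocalizedModule 𝔭.1.asIdeal.primeCompl M)).toNat

lemma length_localized_quotient_self (𝔭 : HeightOnePrime R)
    [IsDomain (Localization.AtPrime 𝔭.1.asIdeal)]
    [IsDiscreteValuationRing (Localization.AtPrime 𝔭.1.asIdeal)] (n : ℕ) :
    Module.length (Localization.AtPrime 𝔭.1.asIdeal)
      (LocalizedModule 𝔭.1.asIdeal.primeCompl (R ⧸ 𝔭.1.asIdeal ^ n)) = n := by
  set S := 𝔭.1.asIdeal.primeCompl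
  set L := Localization.AtPrime 𝔭.1.asIdeal
  have hI : (𝔭.1.asIdeal ^ n).localized' L S (Algebra.linearMap R L) =
      IsLocalRing.maximalIdeal L ^ n := by
    rw [Ideal.localized'_eq_map, Ideal.map_pow, Localization.AtPrime.map_eq_maximalIdeal]
  let e := (IsLocalizedModule.linearEquiv S
    (LocalizedModule.mkLinearMap S (R ⧸ 𝔭.1.asIdeal ^ n))
    ((𝔭.1.asIdeal ^ n).toLocalizedQuotient' L S (Algebra.linearMap R L)))
  rw [(e.extendScalarsOfIsLocalization S L).length_eq, hI]
  exact IsDiscreteValuationRing.length_quotient_pow_maximalIdeal L n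

lemma length_localized_quotient_of_ne {𝔭 𝔮 : HeightOnePrime R} (h : 𝔮 ≠ 𝔭) (n : ℕ) :
    Module.length (Localization.AtPrime 𝔭.1.asIdeal)
      (LocalizedModule 𝔭.1.asIdeal.primeCompl (R ⧸ 𝔮.1.asIdeal ^ n)) = 0 := by
  rw [Module.length_eq_zero_iff, LocalizedModule.subsingleton_iff]
  have hnle : ¬ 𝔮.1.asIdeal ≤ 𝔭.1.asIdeal := by
    intro hle
    have hlt : 𝔮.1.asIdeal < 𝔭.1.asIdeal := lt_of_le_of_ne hle fun he =>
      h (Subtype.ext (PrimeSpectrum.ext he))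
    have : 𝔮.1.asIdeal.FiniteHeight := ⟨Or.inr (by rw [𝔮.2]; exact ENat.one_ne_top)⟩
    have := Ideal.height_strict_mono_of_isPrime hlt
    rw [𝔮.2, 𝔭.2] at this
    exact lt_irrefl _ this
  obtain ⟨s, hs𝔮, hs𝔭⟩ := Set.not_subset.mp hnle
  intro m
  refine ⟨s ^ n, 𝔭.1.asIdeal.primeCompl.pow_mem hs𝔭 n, ?_⟩
  obtain ⟨m, rfl⟩ := Ideal.Quotient.mk_surjective m
  change Ideal.Quotient.mk _ (s ^ n * m) = 0
  exact Ideal.Quotient.eq_zero_iff_mem.mpr (Ideal.mul_mem_right _ _ (Ideal.pow_mem_pow hs𝔮 n))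

/-- If `f : M → ⨁_k R/𝔮_k^{n_k}` is a pseudo-isomorphism, then `e_𝔭` is the sum of the `n_k` with
`𝔮_k = 𝔭`, for each height-one prime `𝔭` whose local ring is a discrete valuation ring. -/
lemma charExponent_eq_sum_of_pseudoIso {ι : Type} [Fintype ι] [DecidableEq (HeightOnePrime R)]
    (𝔮 : ι → HeightOnePrime R) (n : ι → ℕ) (f : M →ₗ[R] ∀ k, R ⧸ (𝔮 k).1.asIdeal ^ n k)
    (𝔭 : HeightOnePrime R) [IsDomain (Localization.AtPrime 𝔭.1.asIdeal)]
    [IsDiscreteValuationRing (Localization.AtPrime 𝔭.1.asIdeal)]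
    (hker : Subsingleton (LocalizedModule 𝔭.1.asIdeal.primeCompl (LinearMap.ker f)))
    (hcoker : Subsingleton (LocalizedModule 𝔭.1.asIdeal.primeCompl
      ((∀ k, R ⧸ (𝔮 k).1.asIdeal ^ n k) ⧸ LinearMap.range f))) :
    charExponent M 𝔭 = ∑ k with 𝔮 k = 𝔭, n k := by
  set S := 𝔭.1.asIdeal.primeCompl
  set L := Localization.AtPrime 𝔭.1.asIdeal
  have h1 := LocalizedModule.map_exact S (LinearMap.ker f).subtype f
    (LinearMap.exact_subtype_ker_map f)
  have h2 := LocalizedModule.map_exact S f (LinearMap.range f).mkQ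
    (LinearMap.exact_map_mkQ_range f)
  have hinj : Function.Injective (LocalizedModule.map S f) := by
    rw [injective_iff_map_eq_zero]
    intro x hx
    obtain ⟨y, rfl⟩ := (h1 x).mp hx
    rw [Subsingleton.elim y 0, map_zero]
  have hsurj : Function.Surjective (LocalizedModule.map S f) := fun y =>
    (h2 y).mp (Subsingleton.elim _ _)
  let e := (LinearEquiv.ofBijective (LocalizedModule.map S f) ⟨hinj, hsurj⟩)
  let g := IsLocalizedModule.linearEquiv S
    (LocalizedModule.mkLinearMap S (∀ k, R ⧸ (𝔮 k).1.asIdeal ^ n k))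
    (LinearMap.pi fun k => LocalizedModule.mkLinearMap S (R ⧸ (𝔮 k).1.asIdeal ^ n k) ∘ₗ
      LinearMap.proj k)
  have hlen : Module.length L (LocalizedModule S M) =
      ∑ k, if 𝔮 k = 𝔭 then (n k : ℕ∞) else 0 := by
    rw [e.length_eq, (g.extendScalarsOfIsLocalization S L).length_eq,
      Module.length_pi_of_fintype]
    refine Finset.sum_congr rfl fun k _ => ?_
    split_ifs with hk
    · subst hk
      exact length_localized_quotient_self (𝔮 k) (n k)
    · exact length_localized_quotient_of_ne hk (n k)
  unfold charExponent
  rw [hlen, ← Finset.sum_filter, ← Nat.cast_sum, ENat.toNat_natCast]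

variable (R)

/-- The characteristic ideal `∏_{ht 𝔭 = 1} 𝔭 ^ e_𝔭` of a finitely generated torsion module
(only finitely many factors differ from `1` if `R` is a Noetherian domain). -/
def charIdeal : Ideal R :=
  ∏ᶠ 𝔭 : HeightOnePrime R, 𝔭.1.asIdeal ^ charExponent M 𝔭

end Char

/-! ### Determinants of two-term complexes of free modules -/

/-- The determinant ideal of a map `φ : P₁ → P₀` of finite free modules of the same rank `n`.
The map `⋀ⁿ φ` is an element of the free rank-one module
`Hom(⋀ⁿ P₁, ⋀ⁿ P₀) = det(P₁)⁻¹ ⊗ det(P₀)`, so it is an element of `R` up to units;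
the ideal generated by it is the image of the pairing
`det(P₀)⁻¹ ⊗ det(P₁) → R, l ⊗ w ↦ l (⋀ⁿ φ w)`. In terms of bases, it is generated by the
determinant of the matrix of `φ`. -/
def determinantIdeal {R : Type*} [CommRing R] {P₁ P₀ : Type*} [AddCommGroup P₁] [Module R P₁]
    [AddCommGroup P₀] [Module R P₀] (φ : P₁ →ₗ[R] P₀) : Ideal R :=
  Ideal.span {r : R | ∃ (l : Module.Dual R (⋀[R]^(Module.finrank R P₀) P₀))
    (w : ⋀[R]^(Module.finrank R P₀) P₁), r = l (exteriorPower.map _ φ w)}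

/-! ### Base change along a ring homomorphism -/

/-- The map `f : M → N`, linear over the ring homomorphism `σ : R → S`, exhibits `N` as the
base change `S ⊗[R] M`. -/
def IsBaseChangeAlong {R S : Type*} [CommRing R] [CommRing S] {σ : R →+* S} {M N : Type*}
    [AddCommGroup M] [Module R M] [AddCommGroup N] [Module S N] (f : M →ₛₗ[σ] N) : Prop :=
  letI : Algebra R S := σ.toAlgebra
  letI : Module R N := Module.compHom N σ
  haveI : IsScalarTower R S N := ⟨fun r s n => mul_smul (σ r) s n⟩
  IsBaseChange S (M := M) (N := N)
    ({ toFun := f, map_add' := f.map_add, map_smul' := fun r m => f.map_smulₛₗ r m } : M →ₗ[R] N)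

/-! ### The distribution algebras -/

section Rings

/-- The radius `ρ_i = p ^ (-1 / (p ^ i (p - 1)))`. -/
def levelRadius (p i : ℕ) : ℝ := (p : ℝ) ^ (-(1 / ((p : ℝ) ^ i * ((p : ℝ) - 1))))

/-- The polyradius `(ρ_i, 1, …, 1)`: the variable of index `0` is `T = γ - 1`, and the others are
the `d` variables `x_1, …, x_d` of the Tate algebra. -/
def levelPolyradius (p d i : ℕ) : Fin (d + 1) → ℝ := Fin.cons (levelRadius p i) fun _ => 1

lemma levelRadius_pos (p : ℕ) [hp : Fact p.Prime] (i : ℕ) : 0 < levelRadius p i :=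
  Real.rpow_pos_of_pos (by exact_mod_cast hp.out.pos) _

lemma levelRadius_le_succ (p : ℕ) [hp : Fact p.Prime] (i : ℕ) :
    levelRadius p i ≤ levelRadius p (i + 1) := by
  have h1 : (1 : ℝ) < p := by exact_mod_cast hp.out.one_lt
  have h2 : (0 : ℝ) < (p : ℝ) - 1 := by linarith
  apply Real.rpow_le_rpow_of_exponent_le h1.le
  apply neg_le_neg
  apply one_div_le_one_div_of_le (by positivity)
  apply mul_le_mul_of_nonneg_right _ h2.le
  exact pow_le_pow_right₀ h1.le (Nat.le_succ i)

lemma isRestricted_of_le {E : Type*} [NormedRing E] {σ : Type*} {c c' : σ → ℝ}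
    (h0 : ∀ s, 0 ≤ c s) (h : ∀ s, c s ≤ c' s) {f : MvPowerSeries σ E}
    (hf : MvPowerSeries.IsRestricted c' f) : MvPowerSeries.IsRestricted c f := by
  refine tendsto_const_nhds.squeeze hf (fun t => ?_) fun t => ?_
  · exact mul_nonneg (norm_nonneg _) (Finset.prod_nonneg fun s _ => pow_nonneg (h0 s) _)
  · exact mul_le_mul_of_nonneg_left
      (Finset.prod_le_prod (fun s _ => pow_nonneg (h0 s) _)
        fun s _ => pow_le_pow_left₀ (h0 s) (h s) _) (norm_nonneg _)

variable (p : ℕ) [Fact p.Prime] (E : Type*) [NormedField E] [IsUltrametricDist E] (d : ℕ)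

/-- The algebra `ℋ_{A,i} = A ⊗̂ ℋ_i` for the Tate algebra `A = E⟨x_1, …, x_d⟩`, where `ℋ_i` is the
algebra of analytic functions of `T = γ - 1` on the closed disc `|T| ≤ ρ_i`. It is the algebra
`E⟨x_1, …, x_d, T/ρ_i⟩` of the power series `∑ c_{j,I} T ^ j x ^ I` over `E` such that
`|c_{j,I}| ρ_i ^ j` tends to zero. -/
def HALevel (i : ℕ) : Subring (MvPowerSeries (Fin (d + 1)) E) :=
  MvPowerSeries.IsRestricted.subring (levelPolyradius p d i)

lemma HALevel_succ_le (i : ℕ) : HALevel p E d (i + 1) ≤ HALevel p E d i := by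
  intro f hf
  refine isRestricted_of_le (fun s => ?_) (fun s => ?_)
    (show MvPowerSeries.IsRestricted (levelPolyradius p d (i + 1)) f from hf)
  · refine Fin.cases ?_ (fun _ => ?_) s
    · exact (levelRadius_pos p i).le
    · exact zero_le_one
  · refine Fin.cases ?_ (fun _ => ?_) s
    · exact levelRadius_le_succ p i
    · exact le_rfl

/-- The algebra `ℋ_A = A ⊗̂ ℋ = ⋂_i ℋ_{A,i}`, the inverse limit of the `ℋ_{A,i}` along the
inclusions. -/
def HA : Subring (MvPowerSeries (Fin (d + 1)) E) := ⨅ i, HALevel p E d i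

/-- The restriction map `ℋ_{A,i+1} → ℋ_{A,i}`. -/
def HALevel.restrict (i : ℕ) : HALevel p E d (i + 1) →+* HALevel p E d i :=
  Subring.inclusion (HALevel_succ_le p E d i)

/-- The restriction map `ℋ_A → ℋ_{A,i}`. -/
def HA.restrict (i : ℕ) : HA p E d →+* HALevel p E d i :=
  Subring.inclusion (iInf_le _ i)

end Rings

/-! ### Coadmissible modules and their cylindrical characteristic ideals -/

/-- A presentation of an `ℋ_A`-module `M` as a coadmissible module `M = lim_i M_i`: finitely
generated `ℋ_{A,i}`-modules `M_i`, transition maps `M_{i+1} → M_i` that induce isomorphisms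
`ℋ_{A,i} ⊗ M_{i+1} ≃ M_i`, and projections `M → M_i` that identify `M` with the inverse limit. -/
structure CoadmissiblePresentation (p : ℕ) [Fact p.Prime] (E : Type*) [NormedField E]
    [IsUltrametricDist E] (d : ℕ) (M : Type*) [AddCommGroup M] [Module (HA p E d) M] where
  /-- The modules `M_i`. -/
  level : ℕ → Type*
  [addCommGroup : ∀ i, AddCommGroup (level i)]
  [module : ∀ i, Module (HALevel p E d i) (level i)]
  finite : ∀ i, Module.Finite (HALevel p E d i) (level i)
  /-- The transition maps `M_{i+1} → M_i`. -/
  trans : ∀ i, level (i + 1) →ₛₗ[HALevel.restrict p E d i] level i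
  isBaseChange : ∀ i, IsBaseChangeAlong (trans i)
  /-- The projections `M → M_i`. -/
  proj : ∀ i, M →ₛₗ[HA.restrict p E d i] level i
  trans_proj : ∀ i m, trans i (proj (i + 1) m) = proj i m
  isLimit : ∀ x : ∀ i, level i, (∀ i, trans i (x (i + 1)) = x i) →
    ∃! m : M, ∀ i, proj i m = x i

attribute [instance] CoadmissiblePresentation.addCommGroup CoadmissiblePresentation.module

/-- The cylindrical characteristic ideal `lim_i char(M_i)` of a torsion coadmissible module
`M = lim_i M_i`, as an ideal of `ℋ_A = lim_i ℋ_{A,i} = ⋂_i ℋ_{A,i}`: the elements whose image in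
`ℋ_{A,i}` lies in `char(M_i)` for all `i`. -/
def CoadmissiblePresentation.charIdeal {p : ℕ} [Fact p.Prime] {E : Type*} [NormedField E]
    [IsUltrametricDist E] {d : ℕ} {M : Type*} [AddCommGroup M] [Module (HA p E d) M]
    (S : CoadmissiblePresentation p E d M) : Ideal (HA p E d) :=
  ⨅ i, (CylChar.charIdeal (HALevel p E d i) (S.level i)).comap (HA.restrict p E d i)

end CylChar

end

/-! Fix a level `i`. The ring `ℋ_{A,i}` consists of restricted series of polyradius `(ρ_i, 1, …,
1)`, and `ρ_i ^ (p ^ i (p - 1)) = |p|`. It is a Noetherian factorial domain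
(`isNoetherianRing_and_ufm_HALevel`), by induction on the number of variables: a shear `x_k ↦ x_k +
b_k T ^ N_k` makes a nonzero series distinguished in `T` up to a unit; Weierstrass division then
bounds the quotient by a polynomial ring, and Weierstrass preparation moves factorisation into a
polynomial ring.

Over a Noetherian factorial domain the cokernel of a square matrix `B` with nonzero determinant has
characteristic ideal `(det B)` (`charIdeal_quotient_range`): at a height-one prime the local ring is
a principal ideal domain, Smith normal form turns the length of the cokernel into the order of `det
B`, and a nonzero element generates the product of the height-one primes raised to its orders.

The analytic point is that the given `M_i` is the cokernel over `ℋ_{A,i}` of the matrix of `φ`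
(`nonempty_level_equiv`). Only `M = lim M_i` and the base change between successive levels are
given, not `ℋ_{A,i} ⊗ M ≃ M_i`. Two facts bridge this: submodules of Noetherian Banach modules are
closed (`isClosed_submodule`), and in an inverse sequence with dense transition maps each element of
a level is approximated by compatible families (`exists_compatible_near`). Applied to the `M_i`,
they show that `M` generates each level. Applied to the kernels of `ℋ_{A,i} ^ n → M_i`, they show
that each kernel lies in the closure of the range of `B`, hence in the range: a compatible family in
the kernels is a vector over `ℋ_A` that dies in `M`.

Finally, an element of `ℋ_A` divisible by `det B ≠ 0` at every level is divisible in `ℋ_A`, because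
the quotient is unique among formal power series (`iInf_comap_span_restrict`). -/

noncomputable section

/-! ### The Gauss norm on rings of restricted power series -/

namespace RestrictedSeries

open Filter Topology

section Weight

variable {σ : Type*} (c : σ → ℝ)

/-- The weight `∏ c_s ^ t_s` of the exponent `t`. -/
def weight (t : σ →₀ ℕ) : ℝ := t.prod (c · ^ ·)

lemma weight_pos {c : σ → ℝ} (hc : ∀ s, 0 < c s) (t : σ →₀ ℕ) : 0 < weight c t :=
  Finset.prod_pos fun s _ => pow_pos (hc s) _

@[simp] lemma weight_zero : weight c 0 = 1 := by simp [weight]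

lemma weight_add (t u : σ →₀ ℕ) : weight c (t + u) = weight c t * weight c u := by
  classical
  simp [weight, Finsupp.prod_add_index', pow_add]

@[simp] lemma weight_single (s : σ) (n : ℕ) : weight c (Finsupp.single s n) = c s ^ n := by
  simp [weight]

end Weight

variable {σ : Type*} (c : σ → ℝ) (A : Type*) [NormedCommRing A] [IsUltrametricDist A]

/-- The ring of restricted power series with polyradius `c`. -/
abbrev Tate : Type _ := ↥(MvPowerSeries.IsRestricted.subring (R := A) c)

variable {c A}

namespace Tate

/-- The weighted norm of a coefficient. -/
def term (f : Tate c A) (t : σ →₀ ℕ) : ℝ := ‖MvPowerSeries.coeff t f.1‖ * weight c t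

lemma tendsto_term (f : Tate c A) : Tendsto f.term cofinite (𝓝 0) := f.2

variable [hc : Fact (∀ s, 0 < c s)]

lemma term_nonneg (f : Tate c A) (t : σ →₀ ℕ) : 0 ≤ f.term t :=
  mul_nonneg (norm_nonneg _) (weight_pos hc.out t).le

omit hc in
lemma finite_le_term (f : Tate c A) {ε : ℝ} (hε : 0 < ε) : {t | ε ≤ f.term t}.Finite := by
  have := f.tendsto_term.eventually (gt_mem_nhds hε)
  rw [eventually_cofinite] at this
  simpa using this

/-- Only finitely many terms reach the size of a given nonzero one, so the supremum defining the
Gauss norm is attained. The strict bounds below depend on this. -/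
lemma exists_term_max (f : Tate c A) : ∃ t, ∀ u, f.term u ≤ f.term t := by
  by_cases h : ∀ u, f.term u = 0
  · exact ⟨0, fun u => by rw [h, h]⟩
  · push Not at h
    obtain ⟨u, hu⟩ := h
    have hpos : 0 < f.term u := lt_of_le_of_ne (f.term_nonneg u) hu.symm
    obtain ⟨t, ht, hmax⟩ := Set.exists_max_image _ f.term (f.finite_le_term hpos) ⟨u, le_refl (f.term u)⟩
    refine ⟨t, fun v => ?_⟩
    by_cases hv : f.term u ≤ f.term v
    · exact hmax v hv
    · exact (not_le.mp hv).le.trans ht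

instance : Norm (Tate c A) := ⟨fun f => ⨆ t, f.term t⟩

omit hc in
lemma norm_def (f : Tate c A) : ‖f‖ = ⨆ t, f.term t := rfl

lemma term_le_norm (f : Tate c A) (t : σ →₀ ℕ) : f.term t ≤ ‖f‖ := by
  obtain ⟨u, hu⟩ := f.exists_term_max
  exact le_ciSup (f := f.term) ⟨f.term u, by rintro _ ⟨v, rfl⟩; exact hu v⟩ t

lemma exists_term_eq_norm (f : Tate c A) : ∃ t, f.term t = ‖f‖ := by
  obtain ⟨u, hu⟩ := f.exists_term_max
  exact ⟨u, le_antisymm (f.term_le_norm u) (ciSup_le hu)⟩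

omit hc in
lemma norm_le_of {f : Tate c A} {C : ℝ} (h : ∀ t, f.term t ≤ C) : ‖f‖ ≤ C := ciSup_le h

lemma norm_lt_of {f : Tate c A} {C : ℝ} (h : ∀ t, f.term t < C) : ‖f‖ < C := by
  obtain ⟨t, ht⟩ := f.exists_term_eq_norm
  exact ht ▸ h t

lemma term_add_le (f g : Tate c A) (t : σ →₀ ℕ) :
    (f + g).term t ≤ max (f.term t) (g.term t) := by
  unfold term
  rw [← max_mul_of_nonneg _ _ (weight_pos hc.out t).le]
  exact mul_le_mul_of_nonneg_right (by simpa using IsUltrametricDist.norm_add_le_max _ _)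
    (weight_pos hc.out t).le

lemma norm_add_le_max' (f g : Tate c A) : ‖f + g‖ ≤ max ‖f‖ ‖g‖ :=
  norm_le_of fun t => (term_add_le f g t).trans (max_le_max (f.term_le_norm t) (g.term_le_norm t))

omit hc in
lemma term_neg (f : Tate c A) (t : σ →₀ ℕ) : (-f).term t = f.term t := by
  simp [term]

omit hc in
lemma term_zero (t : σ →₀ ℕ) : (0 : Tate c A).term t = 0 := by
  simp [term]

lemma norm_nonneg' (f : Tate c A) : 0 ≤ ‖f‖ := (f.term_nonneg 0).trans (f.term_le_norm 0)

lemma eq_zero_of_norm (f : Tate c A) (h : ‖f‖ = 0) : f = 0 := by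
  ext t
  have h1 : f.term t = 0 := le_antisymm (h ▸ f.term_le_norm t) (f.term_nonneg t)
  simpa [term, (weight_pos hc.out t).ne'] using h1

lemma norm_mul_le' (f g : Tate c A) : ‖f * g‖ ≤ ‖f‖ * ‖g‖ := by
  classical
  refine norm_le_of fun t => ?_
  unfold term
  rw [Subring.coe_mul, MvPowerSeries.coeff_mul, ← le_div_iff₀ (weight_pos hc.out t)]
  refine IsUltrametricDist.norm_sum_le_of_forall_le_of_nonneg
    (div_nonneg (mul_nonneg f.norm_nonneg' g.norm_nonneg') (weight_pos hc.out t).le) ?_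
  rintro ⟨u, v⟩ huv
  rw [Finset.HasAntidiagonal.mem_antidiagonal] at huv
  rw [le_div_iff₀ (weight_pos hc.out t), ← huv, weight_add]
  calc _ ≤ (‖MvPowerSeries.coeff u f.1‖ * ‖MvPowerSeries.coeff v g.1‖) *
        (weight c u * weight c v) := mul_le_mul_of_nonneg_right (norm_mul_le _ _)
          (mul_pos (weight_pos hc.out u) (weight_pos hc.out v)).le
    _ = f.term u * g.term v := by unfold term; ring
    _ ≤ _ := mul_le_mul (f.term_le_norm u) (g.term_le_norm v) (g.term_nonneg v) f.norm_nonneg'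

omit hc in
lemma norm_neg' (f : Tate c A) : ‖-f‖ = ‖f‖ := by
  simp only [norm_def, term_neg]

lemma norm_zero' : ‖(0 : Tate c A)‖ = 0 :=
  le_antisymm (norm_le_of fun t => (term_zero t).le) (norm_nonneg' _)

instance : NormedCommRing (Tate c A) where
  __ := (inferInstance : CommRing (Tate c A))
  __ := (inferInstance : Norm (Tate c A))
  dist f g := ‖-f + g‖
  dist_self f := by rw [neg_add_cancel, norm_zero']
  dist_comm f g := by rw [← norm_neg', neg_add_rev, neg_neg]
  dist_triangle f g h := by
    have := (norm_add_le_max' (-f + g) (-g + h)).trans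
      (max_le_add_of_nonneg (norm_nonneg' _) (norm_nonneg' _))
    rwa [add_assoc, add_neg_cancel_left] at this
  eq_of_dist_eq_zero {f g} h := by
    rw [← neg_inj]
    exact eq_neg_of_add_eq_zero_left (eq_zero_of_norm _ h)
  dist_eq f g := rfl
  norm_mul_le := norm_mul_le'

instance : IsUltrametricDist (Tate c A) :=
  IsUltrametricDist.isUltrametricDist_of_forall_norm_add_le_max_norm norm_add_le_max'

lemma norm_coeff_mul_le (f : Tate c A) (t : σ →₀ ℕ) :
    ‖MvPowerSeries.coeff t f.1‖ * weight c t ≤ ‖f‖ := f.term_le_norm t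

lemma norm_coeff_le (f : Tate c A) (t : σ →₀ ℕ) :
    ‖MvPowerSeries.coeff t f.1‖ ≤ ‖f‖ / weight c t := by
  rw [le_div_iff₀ (weight_pos hc.out t)]
  exact f.term_le_norm t

/-- A pointwise limit of coefficients of a Cauchy sequence is restricted. -/
instance [CompleteSpace A] : CompleteSpace (Tate c A) := by
  refine Metric.complete_of_cauchySeq_tendsto fun u hu => ?_
  have hcoef : ∀ t, CauchySeq fun n => MvPowerSeries.coeff t (u n).1 := by
    intro t
    rw [Metric.cauchySeq_iff'] at hu ⊢
    intro ε hε
    obtain ⟨N, hN⟩ := hu (ε * weight c t) (mul_pos hε (weight_pos hc.out t))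
    refine ⟨N, fun n hn => ?_⟩
    have h1 := hN n hn
    rw [dist_eq_norm] at h1 ⊢
    have h2 := norm_coeff_le (u n - u N) t
    rw [AddSubgroupClass.coe_sub, map_sub] at h2
    exact h2.trans_lt (by rwa [div_lt_iff₀ (weight_pos hc.out t)])
  choose g hg using fun t => cauchySeq_tendsto_of_complete (hcoef t)
  -- The index `N` does not depend on `t`: this is the Cauchy estimate with `m → ∞` in each
  -- coefficient.
  have key : ∀ ε > 0, ∃ N, ∀ n ≥ N, ∀ t,
      ‖MvPowerSeries.coeff t (u n).1 - g t‖ * weight c t ≤ ε := by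
    intro ε hε
    rw [Metric.cauchySeq_iff] at hu
    obtain ⟨N, hN⟩ := hu ε hε
    refine ⟨N, fun n hn t => ?_⟩
    have hlim : Tendsto (fun m => ‖MvPowerSeries.coeff t (u n).1 - MvPowerSeries.coeff t (u m).1‖ *
        weight c t) atTop (𝓝 (‖MvPowerSeries.coeff t (u n).1 - g t‖ * weight c t)) :=
      ((tendsto_const_nhds.sub (hg t)).norm).mul_const _
    refine le_of_tendsto hlim (eventually_atTop.mpr ⟨N, fun m hm => ?_⟩)
    have h1 := hN n hn m hm
    rw [dist_eq_norm] at h1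
    have h2 := norm_coeff_mul_le (u n - u m) t
    rw [AddSubgroupClass.coe_sub, map_sub] at h2
    exact h2.trans h1.le
  have hres : MvPowerSeries.IsRestricted c (fun t => g t : MvPowerSeries σ A) := by
    refine Metric.tendsto_nhds.mpr ?_
    intro ε hε
    obtain ⟨N, hN⟩ := key (ε / 2) (half_pos hε)
    refine ((u N).tendsto_term.eventually (gt_mem_nhds hε)).mono fun t ht => ?_
    have hw := weight_pos hc.out t
    change dist (‖g t‖ * weight c t) 0 < ε
    rw [Real.dist_0_eq_abs, abs_of_nonneg (mul_nonneg (norm_nonneg _) hw.le)]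
    have h3 : ‖g t‖ ≤ max ‖MvPowerSeries.coeff t (u N).1 - g t‖ ‖MvPowerSeries.coeff t (u N).1‖ := by
      have := IsUltrametricDist.norm_add_le_max (-(MvPowerSeries.coeff t (u N).1 - g t))
        (MvPowerSeries.coeff t (u N).1)
      rw [norm_neg, neg_sub, sub_add_cancel] at this
      exact this
    calc ‖g t‖ * weight c t ≤ _ := mul_le_mul_of_nonneg_right h3 hw.le
      _ = max _ _ := max_mul_of_nonneg _ _ hw.le
      _ < ε := max_lt ((hN N le_rfl t).trans_lt (half_lt_self hε)) ht
  refine ⟨⟨fun t => g t, hres⟩, ?_⟩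
  rw [Metric.tendsto_atTop]
  intro ε hε
  obtain ⟨N, hN⟩ := key (ε / 2) (half_pos hε)
  refine ⟨N, fun n hn => ?_⟩
  rw [dist_eq_norm]
  exact (norm_le_of fun t => hN n hn t).trans_lt (half_lt_self hε)

/-- The exponents of maximal terms of `f` and `g` form finite nonempty sets. These contain a pair
`(a, b)` whose sum is attained only once, so in the coefficient of `f * g` at `a + b` one product
strictly dominates the others. -/
instance [NormMulClass A] : NormMulClass (Tate c A) where
  norm_mul f g := by
    classical
    refine le_antisymm (norm_mul_le' f g) ?_
    by_cases hf : f = 0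
    · simp [hf]
    by_cases hg : g = 0
    · simp [hg]
    have hf' : 0 < ‖f‖ := norm_pos_iff.mpr hf
    have hg' : 0 < ‖g‖ := norm_pos_iff.mpr hg
    set S := (f.finite_le_term hf').toFinset
    set T := (g.finite_le_term hg').toFinset
    have hS : S.Nonempty := by
      obtain ⟨t, ht⟩ := f.exists_term_eq_norm
      exact ⟨t, by simp [S, ht]⟩
    have hT : T.Nonempty := by
      obtain ⟨t, ht⟩ := g.exists_term_eq_norm
      exact ⟨t, by simp [T, ht]⟩
    obtain ⟨a, ha, b, hb, hab⟩ := UniqueSums.uniqueAdd_of_nonempty hS hT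
    have ha' : f.term a = ‖f‖ := le_antisymm (f.term_le_norm a) (by simpa [S] using ha)
    have hb' : g.term b = ‖g‖ := le_antisymm (g.term_le_norm b) (by simpa [T] using hb)
    have hterm : ∀ u v, ‖MvPowerSeries.coeff u f.1 * MvPowerSeries.coeff v g.1‖ *
        weight c (u + v) = f.term u * g.term v := fun u v => by
      rw [norm_mul, weight_add]; unfold term; ring
    have hdom : ∀ q ∈ Finset.HasAntidiagonal.antidiagonal (a + b), q ≠ (a, b) →
        ‖MvPowerSeries.coeff q.1 f.1 * MvPowerSeries.coeff q.2 g.1‖ <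
          ‖MvPowerSeries.coeff a f.1 * MvPowerSeries.coeff b g.1‖ := by
      rintro ⟨u, v⟩ huv hne
      rw [Finset.HasAntidiagonal.mem_antidiagonal] at huv
      refine lt_of_mul_lt_mul_right ?_ (weight_pos hc.out (a + b)).le
      rw [hterm a b, ha', hb']
      simp only at huv
      rw [← huv, hterm u v]
      by_cases hu : u ∈ S
      · have hv : v ∉ T := fun hv => hne (by
          obtain ⟨h1, h2⟩ := hab hu hv huv
          rw [h1, h2])
        have hv' : g.term v < ‖g‖ := by simpa [T] using hv
        calc f.term u * g.term v ≤ ‖f‖ * g.term v :=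
              mul_le_mul_of_nonneg_right (f.term_le_norm u) (g.term_nonneg v)
          _ < ‖f‖ * ‖g‖ := mul_lt_mul_of_pos_left hv' hf'
      · have hu' : f.term u < ‖f‖ := by simpa [S] using hu
        calc f.term u * g.term v ≤ f.term u * ‖g‖ :=
              mul_le_mul_of_nonneg_left (g.term_le_norm v) (f.term_nonneg u)
          _ < ‖f‖ * ‖g‖ := mul_lt_mul_of_pos_right hu' hg'
    have hcoef : ‖MvPowerSeries.coeff (a + b) (f * g).1‖ =
        ‖MvPowerSeries.coeff a f.1 * MvPowerSeries.coeff b g.1‖ :=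
      MvPowerSeries.antidiagonal_dominant (‖·‖) f.1 g.1 a b
        IsUltrametricDist.isNonarchimedean_norm norm_mul (fun x => (norm_neg x).symm)
        (by simpa only [norm_mul] using hdom)
    calc ‖f‖ * ‖g‖ = f.term a * g.term b := by rw [ha', hb']
      _ = (f * g).term (a + b) := by rw [← hterm, ← hcoef]; rfl
      _ ≤ _ := (f * g).term_le_norm _

end Tate

end RestrictedSeries

/-! ### Weierstrass theory for restricted power series in one variable -/

namespace RestrictedSeries

open Filter Topology

/-- The ring of power series in one variable over `A` that converge on the disc of radius `ρ`. -/
abbrev DiscAlgebra (A : Type*) [NormedCommRing A] [IsUltrametricDist A] (ρ : ℝ) : Type _ :=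
  Tate (fun _ : Unit => ρ) A

namespace DiscAlgebra

variable {A : Type*} [NormedCommRing A] [IsUltrametricDist A] {ρ : ℝ}

instance [h : Fact (0 < ρ)] : Fact (∀ s : Unit, 0 < (fun _ : Unit => ρ) s) := ⟨fun _ => h.out⟩

/-- The `n`-th coefficient. -/
def coeff (n : ℕ) (f : DiscAlgebra A ρ) : A := PowerSeries.coeff n f.1

@[simp] lemma coeff_add (n : ℕ) (f g : DiscAlgebra A ρ) :
    coeff n (f + g) = coeff n f + coeff n g := map_add (PowerSeries.coeff n) f.1 g.1

@[simp] lemma coeff_sub (n : ℕ) (f g : DiscAlgebra A ρ) :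
    coeff n (f - g) = coeff n f - coeff n g := map_sub (PowerSeries.coeff n) f.1 g.1

@[simp] lemma coeff_neg (n : ℕ) (f : DiscAlgebra A ρ) :
    coeff n (-f) = -coeff n f := map_neg (PowerSeries.coeff n) f.1

@[simp] lemma coeff_zero (n : ℕ) : coeff n (0 : DiscAlgebra A ρ) = 0 :=
  map_zero (PowerSeries.coeff n)

lemma coeff_mul (n : ℕ) (f g : DiscAlgebra A ρ) :
    coeff n (f * g) = ∑ q ∈ Finset.HasAntidiagonal.antidiagonal n, coeff q.1 f * coeff q.2 g :=
  PowerSeries.coeff_mul n f.1 g.1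

lemma ext_coeff {f g : DiscAlgebra A ρ} (h : ∀ n, coeff n f = coeff n g) : f = g :=
  Subtype.ext (PowerSeries.ext h)

lemma term_single (f : DiscAlgebra A ρ) (n : ℕ) :
    f.term (Finsupp.single () n) = ‖coeff n f‖ * ρ ^ n := by
  rw [Tate.term, weight_single]
  rfl

lemma term_eq (f : DiscAlgebra A ρ) (t : Unit →₀ ℕ) :
    f.term t = ‖coeff (t ()) f‖ * ρ ^ t () := by
  rw [← term_single]
  congr 1
  ext
  simp

/-- The inclusion of polynomials. -/
def ofPolynomial : Polynomial A →+* DiscAlgebra A ρ :=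
  (Polynomial.coeToPowerSeries.ringHom (R := A)).codRestrict _ fun P => by
    refine (PowerSeries.isRestricted_iff ρ _).mpr (tendsto_nhds_of_eventually_eq ?_)
    rw [eventually_cofinite]
    refine P.support.finite_toSet.subset fun n hn => ?_
    rw [Finset.mem_coe, Polynomial.mem_support_iff]
    rintro h0
    refine hn ?_
    change ‖PowerSeries.coeff n (P : PowerSeries A)‖ * _ = 0
    rw [Polynomial.coeff_coe, h0, norm_zero, zero_mul]

@[simp] lemma coeff_ofPolynomial (P : Polynomial A) (n : ℕ) :
    coeff n (ofPolynomial P : DiscAlgebra A ρ) = P.coeff n := Polynomial.coeff_coe P n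

lemma ofPolynomial_injective : Function.Injective (ofPolynomial : Polynomial A → DiscAlgebra A ρ) :=
  fun P Q h => Polynomial.ext fun n => by
    rw [← coeff_ofPolynomial (ρ := ρ), h, coeff_ofPolynomial]

/-- The truncation of `f` below degree `s`. -/
def trunc (s : ℕ) (f : DiscAlgebra A ρ) : Polynomial A := PowerSeries.trunc s f.1

lemma coeff_trunc (s : ℕ) (f : DiscAlgebra A ρ) (n : ℕ) :
    (trunc s f).coeff n = if n < s then coeff n f else 0 := PowerSeries.coeff_trunc n s f.1

lemma degree_trunc_lt (s : ℕ) (f : DiscAlgebra A ρ) : (trunc s f).degree < s :=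
  PowerSeries.degree_trunc_lt f.1 s

variable [hρ : Fact (0 < ρ)]

lemma norm_coeff_mul_le (f : DiscAlgebra A ρ) (n : ℕ) : ‖coeff n f‖ * ρ ^ n ≤ ‖f‖ :=
  (term_single f n).symm.trans_le (f.term_le_norm _)

omit hρ in
lemma norm_le_of {f : DiscAlgebra A ρ} {C : ℝ} (h : ∀ n, ‖coeff n f‖ * ρ ^ n ≤ C) : ‖f‖ ≤ C :=
  Tate.norm_le_of fun t => (term_eq f t).trans_le (h _)

lemma norm_lt_of {f : DiscAlgebra A ρ} {C : ℝ} (h : ∀ n, ‖coeff n f‖ * ρ ^ n < C) : ‖f‖ < C :=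
  Tate.norm_lt_of fun t => (term_eq f t).trans_lt (h _)

omit hρ in
lemma exists_forall_ge_lt (f : DiscAlgebra A ρ) {ε : ℝ} (hε : 0 < ε) :
    ∃ N, ∀ n ≥ N, ‖coeff n f‖ * ρ ^ n < ε := by
  have := (PowerSeries.isRestricted_iff' ρ f.1).mp f.2
  exact eventually_atTop.mp (this.eventually (gt_mem_nhds hε))

lemma exists_last_max {f : DiscAlgebra A ρ} (hf : f ≠ 0) :
    ∃ k, ‖coeff k f‖ * ρ ^ k = ‖f‖ ∧ ∀ j > k, ‖coeff j f‖ * ρ ^ j < ‖f‖ := by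
  obtain ⟨t, ht⟩ := f.exists_term_eq_norm
  rw [term_eq] at ht
  obtain ⟨N, hN⟩ := f.exists_forall_ge_lt (norm_pos_iff.mpr hf)
  have hex : ∃ k, ‖coeff k f‖ * ρ ^ k = ‖f‖ := ⟨_, ht⟩
  classical
  have hle : ∀ k, ‖coeff k f‖ * ρ ^ k = ‖f‖ → k ≤ N := fun k hk => by
    by_contra h
    exact (hN k (by omega)).ne hk
  refine ⟨Nat.findGreatest (fun k => ‖coeff k f‖ * ρ ^ k = ‖f‖) N,
    Nat.findGreatest_spec (P := fun k => ‖coeff k f‖ * ρ ^ k = ‖f‖) (hle _ ht) ht, fun j hj => ?_⟩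
  refine lt_of_le_of_ne (norm_coeff_mul_le f j) fun h => ?_
  exact Nat.findGreatest_is_greatest hj (hle j h) h

/-- `f` is distinguished of degree `s`: its coefficient of degree `s` is `1`, its term of degree
`s` has maximal norm, and the terms of higher degree are strictly smaller. -/
structure IsDistinguished (f : DiscAlgebra A ρ) (s : ℕ) : Prop where
  coeff_eq : coeff s f = 1
  norm_le : ‖f‖ ≤ ρ ^ s
  lt : ∀ j > s, ‖coeff j f‖ * ρ ^ j < ρ ^ s

/-- Let `k` be the last degree where `q` attains its norm. In degree `k + s` the product of the two
last maximal terms strictly dominates all others, and `r` does not reach that degree. The estimate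
gives uniqueness of division and a closed range for `(q, r) ↦ q * f + r`. -/
lemma IsDistinguished.le_norm_mul_add {f : DiscAlgebra A ρ} {s : ℕ} (hf : IsDistinguished f s)
    (q : DiscAlgebra A ρ) {r : DiscAlgebra A ρ} (hr : ∀ j ≥ s, coeff j r = 0) :
    ‖q‖ * ρ ^ s ≤ ‖q * f + r‖ := by
  by_cases hq : q = 0
  · simp [hq]
  obtain ⟨k, hk, hlt⟩ := exists_last_max hq
  have hq0 : 0 < ‖q‖ := norm_pos_iff.mpr hq
  have hρs : ∀ n, 0 < ρ ^ n := fun n => pow_pos hρ.out n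
  have hdom : ∀ i ∈ Finset.HasAntidiagonal.antidiagonal (k + s), i ≠ (k, s) →
      ‖coeff i.1 q * coeff i.2 f‖ < ‖coeff k q * coeff s f‖ := by
    rintro ⟨a, b⟩ hab hne
    rw [Finset.HasAntidiagonal.mem_antidiagonal] at hab
    simp only at hab ⊢
    rw [hf.coeff_eq, mul_one]
    refine (norm_mul_le _ _).trans_lt (lt_of_mul_lt_mul_right ?_ (hρs (k + s)).le)
    have e1 : ‖coeff a q‖ * ‖coeff b f‖ * ρ ^ (k + s) =
        (‖coeff a q‖ * ρ ^ a) * (‖coeff b f‖ * ρ ^ b) := by rw [← hab, pow_add]; ring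
    have e2 : ‖coeff k q‖ * ρ ^ (k + s) = ‖q‖ * ρ ^ s := by rw [pow_add, ← hk]; ring
    rw [e1, e2]
    rcases lt_trichotomy a k with h | h | h
    · have hb : s < b := by omega
      calc _ ≤ ‖q‖ * (‖coeff b f‖ * ρ ^ b) :=
            mul_le_mul_of_nonneg_right (norm_coeff_mul_le q a)
              (mul_nonneg (norm_nonneg _) (hρs b).le)
        _ < _ := mul_lt_mul_of_pos_left (hf.lt b hb) hq0
    · exact absurd (by rw [h, show b = s by omega]) hne
    · calc _ ≤ (‖coeff a q‖ * ρ ^ a) * ρ ^ s :=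
            mul_le_mul_of_nonneg_left ((norm_coeff_mul_le f b).trans hf.norm_le)
              (mul_nonneg (norm_nonneg _) (hρs a).le)
        _ < _ := mul_lt_mul_of_pos_right (hlt a h) (hρs s)
  have hsum : ‖coeff (k + s) (q * f)‖ = ‖coeff k q * coeff s f‖ := by
    rw [coeff_mul]
    exact IsNonarchimedean.apply_sum_eq_of_lt (f := fun x : A => ‖x‖)
      (l := fun i : ℕ × ℕ => coeff i.1 q * coeff i.2 f) (k := (k, s))
      IsUltrametricDist.isNonarchimedean_norm (fun x => (norm_neg x).symm)
      (Finset.HasAntidiagonal.mem_antidiagonal.mpr rfl) hdom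
  calc ‖q‖ * ρ ^ s = ‖coeff (k + s) (q * f + r)‖ * ρ ^ (k + s) := by
        rw [coeff_add, hr (k + s) (by omega), add_zero, hsum, hf.coeff_eq, mul_one, pow_add, ← hk]
        ring
    _ ≤ _ := norm_coeff_mul_le _ _

lemma IsDistinguished.norm_mul_le {f : DiscAlgebra A ρ} {s : ℕ} (hf : IsDistinguished f s)
    (q : DiscAlgebra A ρ) : ‖q * f‖ ≤ ‖q‖ * ρ ^ s :=
  (_root_.norm_mul_le _ _).trans (mul_le_mul_of_nonneg_left hf.norm_le (norm_nonneg _))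

lemma IsDistinguished.norm_remainder_le {f : DiscAlgebra A ρ} {s : ℕ} (hf : IsDistinguished f s)
    (q : DiscAlgebra A ρ) {r : DiscAlgebra A ρ} (hr : ∀ j ≥ s, coeff j r = 0) :
    ‖r‖ ≤ ‖q * f + r‖ := by
  have h1 : ‖q * f‖ ≤ ‖q * f + r‖ := (hf.norm_mul_le q).trans (hf.le_norm_mul_add q hr)
  calc ‖r‖ = ‖(q * f + r) + -(q * f)‖ := by congr 1; ring
    _ ≤ max ‖q * f + r‖ ‖-(q * f)‖ := IsUltrametricDist.norm_add_le_max _ _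
    _ ≤ _ := max_le le_rfl (by rwa [norm_neg])

lemma IsDistinguished.eq_zero_of_mul_add_eq_zero {f : DiscAlgebra A ρ} {s : ℕ}
    (hf : IsDistinguished f s) {q r : DiscAlgebra A ρ} (hr : ∀ j ≥ s, coeff j r = 0)
    (h : q * f + r = 0) : q = 0 ∧ r = 0 := by
  have hr0 : r = 0 := norm_le_zero_iff.mp ((hf.norm_remainder_le q hr).trans (by simp [h]))
  have hq := hf.le_norm_mul_add q hr
  rw [h, norm_zero] at hq
  refine ⟨norm_le_zero_iff.mp ?_, hr0⟩
  by_contra hlt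
  exact absurd hq (not_le.mpr (mul_pos (not_le.mp hlt) (pow_pos hρ.out s)))

omit hρ in
lemma coeff_ofPolynomial_eq_zero {P : Polynomial A} {s : ℕ} (h : P.degree < s) :
    ∀ j ≥ s, coeff j (ofPolynomial P : DiscAlgebra A ρ) = 0 := fun j hj => by
  rw [coeff_ofPolynomial]
  exact Polynomial.coeff_eq_zero_of_degree_lt (h.trans_le (by exact_mod_cast hj))

variable (A ρ) in
/-- The series without terms of degree at least `s`. -/
def lowDegree (s : ℕ) : AddSubgroup (DiscAlgebra A ρ) where
  carrier := {r | ∀ j ≥ s, coeff j r = 0}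
  zero_mem' := fun j _ => coeff_zero j
  add_mem' := fun ha hb j hj => by rw [coeff_add, ha j hj, hb j hj, add_zero]
  neg_mem' := fun ha j hj => by rw [coeff_neg, ha j hj, neg_zero]

lemma continuous_coeff (n : ℕ) : Continuous (coeff n : DiscAlgebra A ρ → A) := by
  let φ : DiscAlgebra A ρ →+ A := AddMonoidHom.mk' (coeff n) (coeff_add n)
  refine AddMonoidHomClass.continuous_of_bound φ (ρ ^ n)⁻¹ fun f => ?_
  rw [inv_mul_eq_div, le_div_iff₀ (pow_pos hρ.out n)]
  exact norm_coeff_mul_le f n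

lemma isClosed_lowDegree (s : ℕ) : IsClosed (lowDegree A ρ s : Set (DiscAlgebra A ρ)) := by
  have : (lowDegree A ρ s : Set (DiscAlgebra A ρ)) = ⋂ j ≥ s, {r | coeff j r = 0} := by
    ext r
    simp [lowDegree]
  rw [this]
  exact isClosed_biInter fun j _ => isClosed_eq (continuous_coeff j) continuous_const

omit hρ in
lemma ofPolynomial_trunc_of_mem {s : ℕ} {r : DiscAlgebra A ρ} (hr : r ∈ lowDegree A ρ s) :
    ofPolynomial (trunc s r) = r := ext_coeff fun n => by
  rw [coeff_ofPolynomial, coeff_trunc]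
  split_ifs with h
  · rfl
  · exact (hr n (not_lt.mp h)).symm

lemma isDistinguished_of_monic {P : Polynomial A} (hP : P.Monic)
    (h : ‖(ofPolynomial P : DiscAlgebra A ρ)‖ ≤ ρ ^ P.natDegree) :
    IsDistinguished (ofPolynomial P : DiscAlgebra A ρ) P.natDegree where
  coeff_eq := by rw [coeff_ofPolynomial]; exact hP
  norm_le := h
  lt := fun j hj => by
    rw [coeff_ofPolynomial, Polynomial.coeff_eq_zero_of_natDegree_lt hj, norm_zero, zero_mul]
    exact pow_pos hρ.out _

lemma norm_ofPolynomial_trunc_le (s : ℕ) (f : DiscAlgebra A ρ) :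
    ‖(ofPolynomial (trunc s f) : DiscAlgebra A ρ)‖ ≤ ‖f‖ := by
  refine norm_le_of fun n => ?_
  rw [coeff_ofPolynomial, coeff_trunc]
  split_ifs
  · exact norm_coeff_mul_le f n
  · simp

omit hρ in
lemma coeff_sub_trunc (s : ℕ) (f : DiscAlgebra A ρ) (n : ℕ) :
    coeff n (f - ofPolynomial (trunc s f)) = if n < s then 0 else coeff n f := by
  rw [coeff_sub, coeff_ofPolynomial, coeff_trunc]
  split_ifs <;> simp

lemma exists_norm_sub_trunc_lt (f : DiscAlgebra A ρ) {ε : ℝ} (hε : 0 < ε) :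
    ∃ s, ‖f - ofPolynomial (trunc s f)‖ < ε := by
  obtain ⟨N, hN⟩ := f.exists_forall_ge_lt hε
  refine ⟨N, norm_lt_of fun n => ?_⟩
  rw [coeff_sub_trunc]
  split_ifs with h
  · simpa using hε
  · exact hN n (not_lt.mp h)

/-- Cut off above degree `s`, `f` becomes a monic polynomial, and a truncation of `g` can be divided
by it in `A[X]`. The error comes from the discarded tails; that of `f` has norm below `ρ ^ s`, which
gives a contraction factor independent of `g`. -/
lemma IsDistinguished.exists_approx_division [Nontrivial A] {f : DiscAlgebra A ρ} {s : ℕ}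
    (hf : IsDistinguished f s) : ∃ θ < (1 : ℝ), 0 < θ ∧ ∀ g : DiscAlgebra A ρ,
      ∃ q, ∃ r ∈ lowDegree A ρ s, ‖g - (q * f + r)‖ ≤ θ * ‖g‖ := by
  have hρs : ∀ n, 0 < ρ ^ n := fun n => pow_pos hρ.out n
  set f₀ := trunc (s + 1) f
  have hc : f₀.coeff s = 1 := by rw [coeff_trunc, if_pos (by omega), hf.coeff_eq]
  have hdeg : f₀.natDegree = s := by
    refine Polynomial.natDegree_eq_of_le_of_coeff_ne_zero ?_ (by rw [hc]; exact one_ne_zero)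
    rw [Polynomial.natDegree_le_iff_coeff_eq_zero]
    intro N hN
    rw [coeff_trunc, if_neg (by omega)]
  have hmon : f₀.Monic := by rw [Polynomial.Monic, Polynomial.leadingCoeff, hdeg, hc]
  have hf₀ : IsDistinguished (ofPolynomial f₀ : DiscAlgebra A ρ) s := by
    have := isDistinguished_of_monic (ρ := ρ) hmon
      (hdeg.symm ▸ (norm_ofPolynomial_trunc_le _ f).trans hf.norm_le)
    rwa [hdeg] at this
  have hf₁ : ‖f - ofPolynomial f₀‖ < ρ ^ s := norm_lt_of fun n => by
    rw [coeff_sub_trunc]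
    split_ifs with h
    · simpa using hρs s
    · exact hf.lt n (by omega)
  -- The `1 / 2` keeps `θ` positive when `f` is itself a polynomial of degree `s`.
  set θ := max (1 / 2) (‖f - ofPolynomial f₀‖ / ρ ^ s)
  have hθ1 : θ < 1 := max_lt (by norm_num) ((div_lt_one (hρs s)).mpr hf₁)
  have hθ0 : 0 < θ := lt_max_of_lt_left (by norm_num)
  have hθ : ‖f - ofPolynomial f₀‖ ≤ θ * ρ ^ s := by
    rw [← div_le_iff₀ (hρs s)]
    exact le_max_right _ _
  refine ⟨θ, hθ1, hθ0, fun g => ?_⟩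
  by_cases hg : g = 0
  · exact ⟨0, 0, zero_mem _, by simp [hg]⟩
  obtain ⟨m, hm⟩ := exists_norm_sub_trunc_lt g (mul_pos hθ0 (norm_pos_iff.mpr hg))
  set g₁ := trunc m g
  set q : DiscAlgebra A ρ := ofPolynomial (g₁ /ₘ f₀)
  set r : DiscAlgebra A ρ := ofPolynomial (g₁ %ₘ f₀)
  have hr : r ∈ lowDegree A ρ s := by
    refine coeff_ofPolynomial_eq_zero ?_
    have := Polynomial.degree_modByMonic_lt g₁ hmon
    rwa [Polynomial.degree_eq_natDegree hmon.ne_zero, hdeg] at this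
  have hdiv : ofPolynomial g₁ = q * ofPolynomial f₀ + r := by
    rw [← map_mul, ← map_add, mul_comm, add_comm, Polynomial.modByMonic_add_div g₁ f₀]
  have hq : ‖q‖ * ρ ^ s ≤ ‖g‖ :=
    (hf₀.le_norm_mul_add q hr).trans (hdiv ▸ norm_ofPolynomial_trunc_le m g)
  refine ⟨q, r, hr, ?_⟩
  have e : g - (q * f + r) = (g - ofPolynomial g₁) + -(q * (f - ofPolynomial f₀)) := by
    rw [hdiv]; ring
  rw [e]
  refine (IsUltrametricDist.norm_add_le_max _ _).trans (max_le hm.le ?_)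
  rw [norm_neg]
  calc _ ≤ ‖q‖ * ‖f - ofPolynomial f₀‖ := _root_.norm_mul_le _ _
    _ ≤ ‖q‖ * (θ * ρ ^ s) := mul_le_mul_of_nonneg_left hθ (norm_nonneg _)
    _ = θ * (‖q‖ * ρ ^ s) := by ring
    _ ≤ _ := mul_le_mul_of_nonneg_left hq hθ0.le

/-- Weierstrass division. -/
theorem IsDistinguished.exists_division [CompleteSpace A] [Nontrivial A] {f : DiscAlgebra A ρ} {s : ℕ}
    (hf : IsDistinguished f s) (g : DiscAlgebra A ρ) :
    ∃ q : DiscAlgebra A ρ, ∃ r : Polynomial A, r.degree < s ∧ g = q * f + ofPolynomial r := by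
  have hρs : ∀ n, 0 < ρ ^ n := fun n => pow_pos hρ.out n
  let Φ : DiscAlgebra A ρ × lowDegree A ρ s →+ DiscAlgebra A ρ :=
    AddMonoidHom.mk' (fun x => x.1 * f + x.2.1) fun x y => by
      simp only [Prod.fst_add, Prod.snd_add, AddSubgroup.coe_add]; ring
  have : CompleteSpace (lowDegree A ρ s) := (isClosed_lowDegree s).completeSpace_coe
  have hbound : ∀ x, ‖x‖ ≤ (max 1 (ρ ^ s)⁻¹ : ℝ) * ‖Φ x‖ := fun x => by
    rw [Prod.norm_def]
    refine max_le ?_ ?_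
    · calc ‖x.1‖ = (ρ ^ s)⁻¹ * (‖x.1‖ * ρ ^ s) := by field_simp [(hρs s).ne']
        _ ≤ (ρ ^ s)⁻¹ * ‖Φ x‖ := mul_le_mul_of_nonneg_left (hf.le_norm_mul_add x.1 x.2.2)
            (inv_nonneg.mpr (hρs s).le)
        _ ≤ _ := mul_le_mul_of_nonneg_right (le_max_right _ _) (norm_nonneg _)
    · calc ‖x.2‖ ≤ 1 * ‖Φ x‖ := by
            rw [one_mul]; exact hf.norm_remainder_le x.1 x.2.2
        _ ≤ _ := mul_le_mul_of_nonneg_right (le_max_left _ _) (norm_nonneg _)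
  have hanti := AddMonoidHomClass.antilipschitz_of_bound Φ
    (K := ⟨max 1 (ρ ^ s)⁻¹, le_max_of_le_left zero_le_one⟩) hbound
  have hcont : Continuous Φ := by
    change Continuous fun x : DiscAlgebra A ρ × lowDegree A ρ s => x.1 * f + x.2.1
    fun_prop
  have hclosed : IsClosed (Set.range Φ) :=
    hanti.isClosed_range (uniformContinuous_addMonoidHom_of_continuous hcont)
  obtain ⟨θ, hθ1, hθ0, happrox⟩ := hf.exists_approx_division
  -- A point outside the closed range has positive distance `δ` to it. An approximant within `δ /
  -- θ`, corrected by one approximate division, would come closer than `δ`.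
  have hmem : g ∈ Set.range Φ := by
    by_contra hg
    have hne : (Set.range Φ).Nonempty := ⟨_, ⟨0, rfl⟩⟩
    have hpos := (hclosed.notMem_iff_infDist_pos hne).mp hg
    have hlt : Metric.infDist g (Set.range Φ) < Metric.infDist g (Set.range Φ) / θ := by
      rw [lt_div_iff₀ hθ0]
      exact mul_lt_of_lt_one_right hpos hθ1
    obtain ⟨_, ⟨x, rfl⟩, hx⟩ := (Metric.infDist_lt_iff hne).mp hlt
    rw [dist_eq_norm, lt_div_iff₀ hθ0] at hx
    obtain ⟨q, r, hr, hqr⟩ := happrox (g - Φ x)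
    have h1 : Metric.infDist g (Set.range Φ) ≤ dist g (Φ (x + (q, ⟨r, hr⟩))) :=
      Metric.infDist_le_dist_of_mem ⟨_, rfl⟩
    rw [map_add, dist_eq_norm, ← sub_sub] at h1
    exact absurd (h1.trans hqr) (not_le.mpr (by rwa [mul_comm]))
  obtain ⟨x, hx⟩ := hmem
  refine ⟨x.1, trunc s x.2.1, degree_trunc_lt _ _, ?_⟩
  rw [ofPolynomial_trunc_of_mem x.2.2]
  exact hx.symm

end DiscAlgebra

end RestrictedSeries

/-! ### Weierstrass preparation and prime factorisation of distinguished series. -/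

namespace RestrictedSeries

namespace DiscAlgebra

variable {A : Type*} [NormedCommRing A] [IsUltrametricDist A] {ρ : ℝ} [hρ : Fact (0 < ρ)]

/-- Remainders of Weierstrass division are polynomials, so the quotient is an image of `A[X]` and
Hilbert's basis theorem applies. -/
lemma IsDistinguished.isNoetherianRing_quotient [CompleteSpace A] [Nontrivial A]
    [IsNoetherianRing A] {f : DiscAlgebra A ρ} {s : ℕ} (hf : IsDistinguished f s) :
    IsNoetherianRing (DiscAlgebra A ρ ⧸ Ideal.span {f}) := by
  refine isNoetherianRing_of_surjective (Polynomial A) _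
    ((Ideal.Quotient.mk (Ideal.span {f})).comp ofPolynomial) fun x => ?_
  obtain ⟨g, rfl⟩ := Ideal.Quotient.mk_surjective x
  obtain ⟨q, r, -, h⟩ := hf.exists_division g
  refine ⟨r, ?_⟩
  rw [RingHom.comp_apply, Ideal.Quotient.eq, h, sub_add_cancel_right]
  exact neg_mem (Ideal.mul_mem_left _ _ (Ideal.mem_span_singleton_self f))

lemma norm_ofPolynomial_X_pow_le [NormOneClass A] (s : ℕ) :
    ‖(ofPolynomial (Polynomial.X ^ s) : DiscAlgebra A ρ)‖ ≤ ρ ^ s := by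
  refine norm_le_of fun n => ?_
  rw [coeff_ofPolynomial, Polynomial.coeff_X_pow]
  split_ifs with h
  · rw [norm_one, one_mul, h]
  · simpa using (pow_pos hρ.out s).le

/-- Weierstrass preparation. -/
theorem IsDistinguished.exists_associated_monic [CompleteSpace A] [Nontrivial A] [NormOneClass A]
    {f : DiscAlgebra A ρ} {s : ℕ} (hf : IsDistinguished f s) :
    ∃ ω : Polynomial A, ω.Monic ∧ ‖(ofPolynomial ω : DiscAlgebra A ρ)‖ ≤ ρ ^ ω.natDegree ∧
      Associated f (ofPolynomial ω) := by
  -- The monic polynomial sought is `X ^ s - r = q * f`. Dividing `f` back by it yields the inverse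
  -- of `q`, by uniqueness of division.
  obtain ⟨q, r, hr, h⟩ := hf.exists_division (ofPolynomial (Polynomial.X ^ s))
  have hr' : r.degree < (Polynomial.X ^ s : Polynomial A).degree := by
    rwa [Polynomial.degree_X_pow]
  have hmon : (Polynomial.X ^ s - r).Monic := (Polynomial.monic_X_pow s).sub_of_left hr'
  have hdeg : (Polynomial.X ^ s - r).natDegree = s := by
    refine Polynomial.natDegree_eq_of_degree_eq_some ?_
    rw [Polynomial.degree_sub_eq_left_of_degree_lt hr', Polynomial.degree_X_pow]
  have hω : ofPolynomial (Polynomial.X ^ s - r) = q * f := by rw [map_sub, h, add_sub_cancel_right]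
  have hnorm : ‖(ofPolynomial (Polynomial.X ^ s - r) : DiscAlgebra A ρ)‖ ≤ ρ ^ s := by
    rw [map_sub, sub_eq_add_neg]
    refine (IsUltrametricDist.norm_add_le_max _ _).trans
      (max_le (norm_ofPolynomial_X_pow_le s) ?_)
    rw [norm_neg]
    exact (hf.norm_remainder_le q (coeff_ofPolynomial_eq_zero hr)).trans
      (h ▸ norm_ofPolynomial_X_pow_le s)
  have hdist := isDistinguished_of_monic (ρ := ρ) hmon (hdeg.symm ▸ hnorm)
  rw [hdeg] at hdist
  obtain ⟨q', r', hr', h'⟩ := hdist.exists_division f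
  have hz : (q' * q - 1) * f + ofPolynomial r' = 0 := by
    have : f = q' * (q * f) + ofPolynomial r' := hω ▸ h'
    calc _ = (q' * (q * f) + ofPolynomial r') - f := by ring
      _ = 0 := sub_eq_zero.mpr this.symm
  have hu : q' * q = 1 :=
    sub_eq_zero.mp (hf.eq_zero_of_mul_add_eq_zero (coeff_ofPolynomial_eq_zero hr') hz).1
  refine ⟨_, hmon, hdeg.symm ▸ hnorm, ⟨⟨q, q', by rw [mul_comm, hu], hu⟩, ?_⟩⟩
  rw [hω, mul_comm]

/-- Division with remainder in `A[X]` is also a Weierstrass division, and the latter is unique; so a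
quotient in the disc algebra forces the polynomial remainder to vanish. -/
lemma ofPolynomial_dvd_iff [Nontrivial A] {ω : Polynomial A} (hω : ω.Monic)
    (h : ‖(ofPolynomial ω : DiscAlgebra A ρ)‖ ≤ ρ ^ ω.natDegree) (P : Polynomial A) :
    (ofPolynomial ω : DiscAlgebra A ρ) ∣ ofPolynomial P ↔ ω ∣ P := by
  refine ⟨fun ⟨k, hk⟩ => ?_, fun hd => map_dvd ofPolynomial hd⟩
  have hdist := isDistinguished_of_monic (ρ := ρ) hω h
  have hr : (P %ₘ ω).degree < ω.natDegree := by
    rw [← Polynomial.degree_eq_natDegree hω.ne_zero]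
    exact Polynomial.degree_modByMonic_lt P hω
  have hz : (ofPolynomial (P /ₘ ω) - k) * ofPolynomial ω + ofPolynomial (P %ₘ ω) =
      (0 : DiscAlgebra A ρ) := by
    calc _ = ofPolynomial (P %ₘ ω + ω * (P /ₘ ω)) - ofPolynomial ω * k := by
          rw [map_add, map_mul]; ring
      _ = 0 := by rw [Polynomial.modByMonic_add_div, hk, sub_self]
  have := (hdist.eq_zero_of_mul_add_eq_zero (coeff_ofPolynomial_eq_zero hr) hz).2
  rw [← map_zero (ofPolynomial (A := A) (ρ := ρ))] at this
  exact (Polynomial.modByMonic_eq_zero_iff_dvd hω).mp (ofPolynomial_injective this)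

/-- Modulo `ω` both factors may be replaced by their polynomial remainders, so primality is tested
in `A[X]`. -/
lemma prime_ofPolynomial [CompleteSpace A] [IsDomain A] {ω : Polynomial A}
    (hω : ω.Monic) (h : ‖(ofPolynomial ω : DiscAlgebra A ρ)‖ ≤ ρ ^ ω.natDegree) (hp : Prime ω) :
    Prime (ofPolynomial ω : DiscAlgebra A ρ) := by
  have hdist := isDistinguished_of_monic (ρ := ρ) hω h
  have hdvd := ofPolynomial_dvd_iff (ρ := ρ) hω h
  refine ⟨fun h0 => hp.ne_zero (ofPolynomial_injective (h0.trans (map_zero _).symm)), fun hu => ?_,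
    fun a b hab => ?_⟩
  · rw [isUnit_iff_dvd_one, ← map_one (ofPolynomial (A := A) (ρ := ρ)), hdvd] at hu
    exact hp.not_isUnit (isUnit_of_dvd_one hu)
  · obtain ⟨q₁, r₁, -, h₁⟩ := hdist.exists_division a
    obtain ⟨q₂, r₂, -, h₂⟩ := hdist.exists_division b
    have key : (ofPolynomial ω : DiscAlgebra A ρ) ∣ ofPolynomial (r₁ * r₂) := by
      have e : ofPolynomial (r₁ * r₂) = a * b - ofPolynomial ω *
          (q₁ * b + ofPolynomial r₁ * q₂) := by
        rw [map_mul, h₁, h₂]; ring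
      rw [e]
      exact dvd_sub hab (dvd_mul_right _ _)
    rw [hdvd] at key
    refine (hp.dvd_or_dvd key).imp (fun hd => ?_) (fun hd => ?_)
    · rw [h₁]
      exact dvd_add (dvd_mul_left _ _) (map_dvd _ hd)
    · rw [h₂]
      exact dvd_add (dvd_mul_left _ _) (map_dvd _ hd)

lemma pow_natDegree_le_norm [NormOneClass A] {P : Polynomial A} (hP : P.Monic) :
    ρ ^ P.natDegree ≤ ‖(ofPolynomial P : DiscAlgebra A ρ)‖ := by
  have := norm_coeff_mul_le (ofPolynomial P : DiscAlgebra A ρ) P.natDegree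
  rwa [coeff_ofPolynomial, hP.coeff_natDegree, norm_one, one_mul] at this

/-- The norm bound passes to monic factors: the norm is multiplicative and `pow_natDegree_le_norm`
bounds each factor from below, so neither can exceed its share. Hence the factorisation in `A[X]`
stays among distinguished polynomials. -/
lemma exists_prime_factors_ofPolynomial [CompleteSpace A] [IsDomain A] [NormMulClass A]
    [UniqueFactorizationMonoid A] (n : ℕ) : ∀ ω : Polynomial A, ω.natDegree = n → ω.Monic →
      ‖(ofPolynomial ω : DiscAlgebra A ρ)‖ ≤ ρ ^ ω.natDegree →
      ∃ s : Multiset (DiscAlgebra A ρ), (∀ x ∈ s, Prime x) ∧ s.prod = ofPolynomial ω := by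
  have : NormOneClass A := NormMulClass.toNormOneClass
  induction n using Nat.strong_induction_on with
  | _ n ih =>
  intro ω hn hω h
  by_cases h1 : ω = 1
  · exact ⟨0, by simp, by simp [h1]⟩
  by_cases hirr : Irreducible ω
  · exact ⟨{ofPolynomial ω}, by
      simpa using prime_ofPolynomial hω h (UniqueFactorizationMonoid.irreducible_iff_prime.mp hirr),
      by simp⟩
  · rw [hω.irreducible_iff_natDegree'] at hirr
    push Not at hirr
    obtain ⟨P, Q, hP, hQ, rfl, hmem⟩ := hirr h1
    rw [hP.natDegree_mul hQ, Finset.mem_Ioc] at hmem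
    rw [hP.natDegree_mul hQ] at hn
    rw [map_mul, norm_mul, hP.natDegree_mul hQ, pow_add] at h
    have hP' := pow_natDegree_le_norm (ρ := ρ) hP
    have hQ' := pow_natDegree_le_norm (ρ := ρ) hQ
    have hPpos := pow_pos hρ.out P.natDegree
    have hQpos := pow_pos hρ.out Q.natDegree
    have hPle : ‖(ofPolynomial P : DiscAlgebra A ρ)‖ ≤ ρ ^ P.natDegree := by
      refine le_of_mul_le_mul_right (le_trans ?_ h) hQpos
      exact mul_le_mul_of_nonneg_left hQ' (norm_nonneg _)
    have hQle : ‖(ofPolynomial Q : DiscAlgebra A ρ)‖ ≤ ρ ^ Q.natDegree := by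
      refine le_of_mul_le_mul_left (le_trans ?_ h) hPpos
      exact mul_le_mul_of_nonneg_right hP' (norm_nonneg _)
    obtain ⟨s, hs, hs'⟩ := ih P.natDegree (by omega) P rfl hP hPle
    obtain ⟨t, ht, ht'⟩ := ih Q.natDegree (by omega) Q rfl hQ hQle
    refine ⟨s + t, fun x hx => ?_, by rw [Multiset.prod_add, hs', ht', map_mul]⟩
    exact (Multiset.mem_add.mp hx).elim (hs x) (ht x)

/-- A distinguished series over a factorial ring is a product of primes. -/
theorem IsDistinguished.exists_prime_factors [CompleteSpace A] [IsDomain A] [NormMulClass A]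
    [UniqueFactorizationMonoid A] {f : DiscAlgebra A ρ} {s : ℕ} (hf : IsDistinguished f s) :
    ∃ t : Multiset (DiscAlgebra A ρ), (∀ x ∈ t, Prime x) ∧ Associated t.prod f := by
  have : NormOneClass A := NormMulClass.toNormOneClass
  obtain ⟨ω, hω, hn, hassoc⟩ := hf.exists_associated_monic
  obtain ⟨t, ht, hprod⟩ := exists_prime_factors_ofPolynomial _ ω rfl hω hn
  exact ⟨t, ht, hprod ▸ hassoc.symm⟩

end DiscAlgebra

end RestrictedSeries

/-! ### Separating the first variable -/

namespace RestrictedSeries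

open Filter Topology

/-- The polyradius `(ρ, c)`. -/
abbrev consRadius {n : ℕ} (ρ : ℝ) (c : Fin n → ℝ) : Fin (n + 1) → ℝ := Fin.cons ρ c

instance {n : ℕ} {ρ : ℝ} {c : Fin n → ℝ} [hρ : Fact (0 < ρ)] [hc : Fact (∀ s, 0 < c s)] :
    Fact (∀ s, 0 < consRadius ρ c s) := ⟨Fin.cases hρ.out hc.out⟩

lemma weight_cons {n : ℕ} (ρ : ℝ) (c : Fin n → ℝ) (k : ℕ) (t : Fin n →₀ ℕ) :
    weight (consRadius ρ c) (t.cons k) = ρ ^ k * weight c t := by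
  simp only [weight, consRadius]
  rw [Finsupp.prod_fintype _ _ (by simp), Finsupp.prod_fintype _ _ (by simp), Fin.prod_univ_succ]
  simp

namespace Tate

variable {n : ℕ} {ρ : ℝ} {c : Fin n → ℝ} [hρ : Fact (0 < ρ)] [hc : Fact (∀ s, 0 < c s)]
  {A : Type*} [NormedCommRing A] [IsUltrametricDist A]

/-- A power series with restricted coefficients as a power series in one more variable. -/
def ofDiscAlgebraAux : DiscAlgebra (Tate c A) ρ →+* MvPowerSeries (Fin (n + 1)) A :=
  ((MvPowerSeries.finSuccEquiv A n).symm : _ →+* _).comp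
    ((PowerSeries.map (Subring.subtype (MvPowerSeries.IsRestricted.subring c))).comp
      (Subring.subtype (PowerSeries.IsRestricted.subring (R := Tate c A) ρ)))

omit hρ in
lemma coeff_ofDiscAlgebraAux (g : DiscAlgebra (Tate c A) ρ) (k : ℕ) (t : Fin n →₀ ℕ) :
    MvPowerSeries.coeff (t.cons k) (ofDiscAlgebraAux g) =
      MvPowerSeries.coeff t (DiscAlgebra.coeff k g).1 := by
  rw [← MvPowerSeries.coeff_coeff_finSuccEquiv]
  simp only [ofDiscAlgebraAux, DiscAlgebra.coeff, RingHom.comp_apply]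
  erw [AlgEquiv.apply_symm_apply]
  rfl

omit hρ in
lemma term_ofDiscAlgebraAux (g : DiscAlgebra (Tate c A) ρ) (k : ℕ) (t : Fin n →₀ ℕ) :
    ‖MvPowerSeries.coeff (t.cons k) (ofDiscAlgebraAux g)‖ * weight (consRadius ρ c) (t.cons k) =
      (DiscAlgebra.coeff k g).term t * ρ ^ k := by
  rw [coeff_ofDiscAlgebraAux, weight_cons, term]; ring

lemma ofDiscAlgebraAux_mem (g : DiscAlgebra (Tate c A) ρ) :
    ofDiscAlgebraAux g ∈ MvPowerSeries.IsRestricted.subring (consRadius ρ c) := by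
  refine Metric.tendsto_nhds.mpr fun ε hε => ?_
  rw [eventually_cofinite]
  obtain ⟨N, hN⟩ := g.exists_forall_ge_lt hε
  have hfin : ∀ k, {t | ε / ρ ^ k ≤ (DiscAlgebra.coeff k g).term t}.Finite := fun k =>
    finite_le_term _ (div_pos hε (pow_pos hρ.out k))
  refine ((Set.finite_lt_nat N).biUnion fun k _ => (hfin k).image (Finsupp.cons k)).subset ?_
  intro m hm
  rw [← Finsupp.cons_tail m] at hm ⊢
  set k := m 0
  set t := m.tail
  have hρk := pow_pos hρ.out k
  have hm' : ε ≤ (DiscAlgebra.coeff k g).term t * ρ ^ k := by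
    rw [← term_ofDiscAlgebraAux]
    rw [Set.mem_ofPred_eq, Real.dist_0_eq_abs, not_lt] at hm
    exact hm.trans_eq (abs_of_nonneg (mul_nonneg (norm_nonneg _)
      (weight_pos (Fact.out : ∀ s, 0 < consRadius ρ c s) _).le))
  have hk : k < N := by
    by_contra h
    exact absurd (hm'.trans (mul_le_mul_of_nonneg_right (term_le_norm _ t) hρk.le))
      (not_le.mpr (hN k (not_lt.mp h)))
  exact Set.mem_biUnion hk ⟨t, (div_le_iff₀ hρk).mpr hm', rfl⟩

/-- The same as `ofDiscAlgebraAux`, with values in the restricted series. -/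
def ofDiscAlgebra : DiscAlgebra (Tate c A) ρ →+* Tate (consRadius ρ c) A :=
  ofDiscAlgebraAux.codRestrict _ ofDiscAlgebraAux_mem

lemma coeff_ofDiscAlgebra (g : DiscAlgebra (Tate c A) ρ) (k : ℕ) (t : Fin n →₀ ℕ) :
    MvPowerSeries.coeff (t.cons k) (ofDiscAlgebra g).1 =
      MvPowerSeries.coeff t (DiscAlgebra.coeff k g).1 := coeff_ofDiscAlgebraAux g k t

lemma term_ofDiscAlgebra (g : DiscAlgebra (Tate c A) ρ) (k : ℕ) (t : Fin n →₀ ℕ) :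
    (ofDiscAlgebra g).term (t.cons k) = (DiscAlgebra.coeff k g).term t * ρ ^ k :=
  term_ofDiscAlgebraAux g k t

/-- For surjectivity, the finitely many exponents with term at least `ε` involve only finitely many
powers of `T`; so the norms of the coefficients of `T ^ k`, times `ρ ^ k`, tend to zero. -/
lemma ofDiscAlgebra_bijective : Function.Bijective
    (ofDiscAlgebra : DiscAlgebra (Tate c A) ρ → Tate (consRadius ρ c) A) := by
  refine ⟨fun g g' h => DiscAlgebra.ext_coeff fun k => Subtype.ext (MvPowerSeries.ext fun t => ?_),
    fun f => ?_⟩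
  · rw [← coeff_ofDiscAlgebra, h, coeff_ofDiscAlgebra]
  · have hres : ∀ k, MvPowerSeries.IsRestricted c
        (PowerSeries.coeff k (MvPowerSeries.finSuccEquiv A n f.1)) := fun k => by
      have h1 := (f.tendsto_term.comp (Finsupp.cons_right_injective (M := ℕ) (n := n)
        k).tendsto_cofinite).mul_const (ρ ^ k)⁻¹
      rw [zero_mul] at h1
      refine h1.congr fun t => ?_
      have hρk := (pow_pos hρ.out k).ne'
      rw [MvPowerSeries.coeff_coeff_finSuccEquiv, Function.comp_apply, term, weight_cons]
      change _ = _ * weight c t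
      field_simp
    let a : ℕ → Tate c A := fun k => ⟨_, hres k⟩
    have ha : ∀ k t, (a k).term t * ρ ^ k = f.term (t.cons k) := fun k t => by
      simp only [term, a, MvPowerSeries.coeff_coeff_finSuccEquiv, weight_cons]; ring
    have hg : PowerSeries.IsRestricted ρ (PowerSeries.mk a) := by
      rw [PowerSeries.isRestricted_iff]
      refine Metric.tendsto_nhds.mpr fun ε hε => ?_
      rw [eventually_cofinite]
      refine ((f.finite_le_term hε).image fun m => m 0).subset fun k hk => ?_
      obtain ⟨t, ht⟩ := (a k).exists_term_eq_norm
      refine ⟨t.cons k, ?_, Finsupp.cons_zero _ _⟩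
      rw [Set.mem_ofPred_eq, ← ha, ht]
      rw [Set.mem_ofPred_eq, Real.dist_0_eq_abs, not_lt, PowerSeries.coeff_mk] at hk
      exact hk.trans_eq (abs_of_nonneg (mul_nonneg (norm_nonneg _) (pow_pos hρ.out k).le))
    refine ⟨⟨PowerSeries.mk a, hg⟩, Subtype.ext (MvPowerSeries.ext fun m => ?_)⟩
    rw [← Finsupp.cons_tail m, coeff_ofDiscAlgebra, DiscAlgebra.coeff, PowerSeries.coeff_mk,
      MvPowerSeries.coeff_coeff_finSuccEquiv]

/-- Restricted series in `n + 1` variables as restricted series in the first variable over the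
ring of restricted series in the others. -/
def discAlgebraEquiv : Tate (consRadius ρ c) A ≃+* DiscAlgebra (Tate c A) ρ :=
  (RingEquiv.ofBijective (ofDiscAlgebra (ρ := ρ) (c := c) (A := A)) ofDiscAlgebra_bijective).symm

lemma term_coeff_discAlgebraEquiv (f : Tate (consRadius ρ c) A) (k : ℕ) (t : Fin n →₀ ℕ) :
    (DiscAlgebra.coeff k (discAlgebraEquiv f)).term t * ρ ^ k = f.term (t.cons k) := by
  rw [← term_ofDiscAlgebra]
  congr 1
  exact (RingEquiv.ofBijective (ofDiscAlgebra (ρ := ρ) (c := c) (A := A)) ofDiscAlgebra_bijective).apply_symm_apply f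

/-- The constant series. -/
def const {σ : Type*} (c : σ → ℝ) (A : Type*) [NormedCommRing A] [IsUltrametricDist A] :
    A →+* Tate c A :=
  (MvPowerSeries.C (σ := σ)).codRestrict _ fun a => MvPowerSeries.isRestricted_C c a

lemma norm_const {σ : Type*} {c : σ → ℝ} [Fact (∀ s, 0 < c s)] (a : A) : ‖const c A a‖ = ‖a‖ := by
  classical
  refine le_antisymm (norm_le_of fun t => ?_) ?_
  · rw [term]
    change ‖MvPowerSeries.coeff t (MvPowerSeries.C a)‖ * _ ≤ _
    rw [MvPowerSeries.coeff_C]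
    split_ifs with h
    · simp [h]
    · simp
  · have := term_le_norm (const c A a) 0
    rw [term, weight_zero, mul_one] at this
    change ‖MvPowerSeries.coeff 0 (MvPowerSeries.C a)‖ ≤ _ at this
    rwa [MvPowerSeries.coeff_zero_C] at this

/-- If the monomial `T ^ s` dominates strictly all other monomials whose exponent of `T` is at least
`s`, then the series is distinguished up to a unit. -/
lemma exists_isDistinguished {E : Type*} [NormedField E] [IsUltrametricDist E] [CompleteSpace E]
    {f : Tate (consRadius ρ c) E} (hf : f ≠ 0) {s : ℕ} (hs : f.term (Finsupp.single 0 s) = ‖f‖)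
    (hlt : ∀ m, s ≤ m 0 → m ≠ Finsupp.single 0 s → f.term m < ‖f‖) :
    ∃ u : DiscAlgebra (Tate c E) ρ, IsUnit u ∧
      DiscAlgebra.IsDistinguished (u * discAlgebraEquiv f) s := by
  have hρs : ∀ k, 0 < ρ ^ k := fun k => pow_pos hρ.out k
  have hcons : (Finsupp.single 0 s : Fin (n + 1) →₀ ℕ) = Finsupp.cons s 0 := by
    ext i; refine Fin.cases ?_ (fun j => ?_) i <;> simp
  set a : ℕ → Tate c E := fun k => DiscAlgebra.coeff k (discAlgebraEquiv f)
  have hterm : ∀ k t, (a k).term t * ρ ^ k = f.term (t.cons k) := term_coeff_discAlgebraEquiv f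
  set x : E := MvPowerSeries.coeff 0 (a s).1
  have hxs : ‖x‖ * ρ ^ s = ‖f‖ := by
    rw [← hs, hcons, ← hterm, term, weight_zero, mul_one]
  have hf0 : 0 < ‖f‖ := norm_pos_iff.mpr hf
  have hx0 : 0 < ‖x‖ := by
    by_contra h
    rw [le_antisymm (not_lt.mp h) (norm_nonneg _), zero_mul] at hxs
    exact hf0.ne hxs
  have hx : x ≠ 0 := norm_pos_iff.mp hx0
  -- The coefficient of `T ^ s` is a nonzero constant up to a strictly smaller error, hence a unit
  -- by the geometric series. Its inverse `v` is the unit that normalises `f`.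
  have hsub : ‖const c E x - a s‖ < ‖x‖ := by
    refine norm_lt_of fun t => ?_
    by_cases ht : t = 0
    · subst ht
      have : MvPowerSeries.coeff 0 (const c E x - a s).1 = 0 := by
        rw [AddSubgroupClass.coe_sub, map_sub]
        exact sub_eq_zero.mpr (MvPowerSeries.coeff_zero_C x)
      rw [term, this, norm_zero, zero_mul]
      exact hx0
    · have : (const c E x - a s).term t = (a s).term t := by
        classical
        have : MvPowerSeries.coeff t (const c E x - a s).1 = - MvPowerSeries.coeff t (a s).1 := by
          rw [AddSubgroupClass.coe_sub, map_sub]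
          change MvPowerSeries.coeff t (MvPowerSeries.C x) - _ = _
          rw [MvPowerSeries.coeff_C, if_neg ht, zero_sub]
        rw [term, this, norm_neg, term]
      rw [this]
      refine lt_of_mul_lt_mul_right ?_ (hρs s).le
      rw [hterm, hxs]
      refine hlt _ (by simp) ?_
      rw [hcons]
      exact fun h => ht (Finsupp.cons_right_injective s h)
  have hunit : IsUnit (a s) := by
    have h1 : ‖1 - const c E x⁻¹ * a s‖ < 1 := by
      have : 1 - const c E x⁻¹ * a s = const c E x⁻¹ * (const c E x - a s) := by
        rw [mul_sub, ← map_mul, inv_mul_cancel₀ hx, map_one]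
      rw [this, norm_mul, norm_const, norm_inv, inv_mul_eq_div, div_lt_one hx0]
      exact hsub
    have h2 := isUnit_one_sub_of_norm_lt_one h1
    rw [sub_sub_cancel] at h2
    exact isUnit_of_mul_isUnit_right h2
  have has : ‖a s‖ = ‖x‖ := by
    have h1 : ‖a s‖ ≤ ‖x‖ := by
      have := IsUltrametricDist.norm_add_le_max (const c E x) (-(const c E x - a s))
      rw [neg_sub, add_sub_cancel, norm_const, ← norm_neg (a s - _), neg_sub] at this
      exact this.trans (max_le le_rfl hsub.le)
    refine le_antisymm h1 ?_
    have := term_le_norm (a s) 0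
    rwa [term, weight_zero, mul_one] at this
  obtain ⟨v, hv⟩ := hunit.exists_left_inv
  have hvn : ‖v‖ = ‖x‖⁻¹ := by
    have h1 := congrArg norm hv
    have : NormOneClass (Tate c E) := NormMulClass.toNormOneClass
    rw [norm_mul, norm_one, has] at h1
    exact eq_inv_of_mul_eq_one_left h1
  have hcoef : ∀ j, DiscAlgebra.coeff j (DiscAlgebra.ofPolynomial (Polynomial.C v) *
      discAlgebraEquiv f) = v * a j := fun j => by
    have : (DiscAlgebra.ofPolynomial (Polynomial.C v) : DiscAlgebra (Tate c E) ρ).1 =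
      PowerSeries.C v := Polynomial.coe_C v
    rw [DiscAlgebra.coeff, Subring.coe_mul, this]
    exact PowerSeries.coeff_C_mul j _ v
  refine ⟨DiscAlgebra.ofPolynomial (Polynomial.C v), ?_, ?_, ?_, ?_⟩
  · exact (IsUnit.of_mul_eq_one _ hv).map
      ((DiscAlgebra.ofPolynomial (A := Tate c E) (ρ := ρ)).comp Polynomial.C)
  · rw [hcoef, hv]
  · refine DiscAlgebra.norm_le_of fun k => ?_
    rw [hcoef, norm_mul, hvn]
    obtain ⟨t, ht⟩ := (a k).exists_term_eq_norm
    rw [mul_assoc, ← ht, hterm, inv_mul_le_iff₀ hx0, hxs]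
    exact term_le_norm _ _
  · intro j hj
    rw [hcoef, norm_mul, hvn]
    obtain ⟨t, ht⟩ := (a j).exists_term_eq_norm
    rw [mul_assoc, ← ht, hterm, inv_mul_lt_iff₀ hx0, hxs]
    refine hlt _ (by simpa using hj.le) fun h => ?_
    rw [hcons] at h
    have := congrArg (fun m : Fin (n + 1) →₀ ℕ => m 0) h
    simp at this
    omega

end Tate

end RestrictedSeries

/-! ### Substitutions in restricted power series -/

namespace RestrictedSeries

open Filter Topology

namespace Tate

section Subst

variable {σ : Type*} {c : σ → ℝ} [hc : Fact (∀ s, 0 < c s)]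
  {E : Type*} [NormedField E] [IsUltrametricDist E]

/-- The monomial of exponent `d` in the family `a`. -/
def monomialIn (a : σ → Tate c E) (d : σ →₀ ℕ) : Tate c E := d.prod fun s k => a s ^ k

omit hc in
lemma coe_monomialIn (a : σ → Tate c E) (d : σ →₀ ℕ) :
    (monomialIn a d).1 = d.prod fun s k => (a s).1 ^ k := by
  simp [monomialIn, Finsupp.prod]

lemma norm_monomialIn_le {a : σ → Tate c E} (ha : ∀ s, ‖a s‖ ≤ c s) (d : σ →₀ ℕ) :
    ‖monomialIn a d‖ ≤ weight c d := by
  have : NormOneClass (Tate c E) := NormMulClass.toNormOneClass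
  rw [monomialIn, weight, Finsupp.prod, Finsupp.prod, norm_prod]
  refine Finset.prod_le_prod (fun s _ => norm_nonneg _) fun s _ => ?_
  rw [norm_pow]
  exact pow_le_pow_left₀ (norm_nonneg _) (ha s) _

variable {a : σ → Tate c E} (ha : MvPowerSeries.HasSubst fun s => (a s).1)

include ha in
omit hc in
-- Each coefficient of a substituted series is a `finsum`, so ultrametric bounds can be checked
-- product by product, without any convergence argument.
lemma term_subst_induction (f : MvPowerSeries σ E) (e : σ →₀ ℕ) (P : E → Prop) (h0 : P 0)
    (hadd : ∀ x y, P x → P y → P (x + y))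
    (h : ∀ d, P (MvPowerSeries.coeff d f * MvPowerSeries.coeff e (monomialIn a d).1)) :
    P (MvPowerSeries.coeff e (MvPowerSeries.subst (fun s => (a s).1) f)) := by
  rw [MvPowerSeries.coeff_subst ha]
  refine finsum_induction P h0 hadd fun d => ?_
  rw [← coe_monomialIn]
  exact h d

omit hc in
lemma norm_coeff_mul_coeff_monomialIn (f : Tate c E) (d e : σ →₀ ℕ) :
    ‖MvPowerSeries.coeff d f.1 * MvPowerSeries.coeff e (monomialIn a d).1‖ * weight c e =
      ‖MvPowerSeries.coeff d f.1‖ * (monomialIn a d).term e := by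
  rw [norm_mul, term, mul_assoc]

include ha in
lemma term_subst_lt {f : Tate c E} {e : σ →₀ ℕ} {C : ℝ} (hC : 0 < C)
    (h : ∀ d, ‖MvPowerSeries.coeff d f.1‖ * (monomialIn a d).term e < C) :
    ‖MvPowerSeries.coeff e (MvPowerSeries.subst (fun s => (a s).1) f.1)‖ * weight c e < C := by
  have hw := weight_pos hc.out e
  refine term_subst_induction ha f.1 e (fun x => ‖x‖ * weight c e < C) (by simpa using hC)
    (fun x y hx hy => ?_) fun d => ?_
  · calc ‖x + y‖ * weight c e ≤ max ‖x‖ ‖y‖ * weight c e :=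
          mul_le_mul_of_nonneg_right (IsUltrametricDist.norm_add_le_max x y) hw.le
      _ = max (‖x‖ * weight c e) (‖y‖ * weight c e) := max_mul_of_nonneg _ _ hw.le
      _ < C := max_lt hx hy
  · rw [norm_coeff_mul_coeff_monomialIn]
    exact h d

lemma norm_coeff_mul_term_monomialIn_le (hle : ∀ s, ‖a s‖ ≤ c s) (f : Tate c E) (d e : σ →₀ ℕ) :
    ‖MvPowerSeries.coeff d f.1‖ * (monomialIn a d).term e ≤ f.term d :=
  mul_le_mul_of_nonneg_left ((term_le_norm _ e).trans (norm_monomialIn_le hle d)) (norm_nonneg _)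

include ha in
-- A term of size at least `ε` at `e` must come from some exponent `d` with `f.term d ≥ ε`. There
-- are finitely many such `d`, and each monomial in the `a s` has finitely many large terms.
lemma isRestricted_subst (hle : ∀ s, ‖a s‖ ≤ c s) (f : Tate c E) :
    MvPowerSeries.IsRestricted c (MvPowerSeries.subst (fun s => (a s).1) f.1) := by
  refine Metric.tendsto_nhds.mpr fun ε hε => ?_
  rw [eventually_cofinite]
  have hfin : ∀ d, {e | ε ≤ ‖MvPowerSeries.coeff d f.1‖ * (monomialIn a d).term e}.Finite :=
    fun d => by
      have := (monomialIn a d).tendsto_term.const_mul ‖MvPowerSeries.coeff d f.1‖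
      rw [mul_zero] at this
      have := this.eventually (gt_mem_nhds hε)
      rw [eventually_cofinite] at this
      simpa using this
  refine ((f.finite_le_term hε).biUnion fun d _ => hfin d).subset fun e he => ?_
  by_contra hne
  refine he ?_
  have hw := weight_pos hc.out e
  change dist (_ * weight c e) 0 < ε
  rw [Real.dist_0_eq_abs, abs_of_nonneg (mul_nonneg (norm_nonneg _) hw.le)]
  refine term_subst_lt ha hε fun d => ?_
  by_contra h
  rw [not_lt] at h
  exact hne (Set.mem_biUnion (h.trans (norm_coeff_mul_term_monomialIn_le hle f d e)) h)

/-- The substitution `x_s ↦ a_s` for a family with `‖a_s‖ ≤ c_s`. -/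
def substHom (hle : ∀ s, ‖a s‖ ≤ c s) : Tate c E →+* Tate c E :=
  ((MvPowerSeries.substAlgHom (R := E) ha : MvPowerSeries σ E →+* MvPowerSeries σ E).comp
    (Subring.subtype _)).codRestrict _ fun f => by
      have := isRestricted_subst ha hle f
      rw [← MvPowerSeries.substAlgHom_apply ha] at this
      exact this

lemma coe_substHom (hle : ∀ s, ‖a s‖ ≤ c s) (f : Tate c E) :
    (substHom ha hle f).1 = MvPowerSeries.subst (fun s => (a s).1) f.1 :=
  MvPowerSeries.substAlgHom_apply ha f.1

/-- The variable `x_s`. -/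
def X (s : σ) : Tate c E := ⟨MvPowerSeries.X s, MvPowerSeries.isRestricted_monomial c _ 1⟩

lemma norm_X_le (s : σ) : ‖(X s : Tate c E)‖ ≤ c s := by
  classical
  refine norm_le_of fun t => ?_
  rw [term]
  change ‖MvPowerSeries.coeff t (MvPowerSeries.X s)‖ * _ ≤ _
  rw [MvPowerSeries.coeff_X]
  split_ifs with h
  · rw [h, weight_single, norm_one, one_mul, pow_one]
  · simpa using (hc.out s).le

end Subst

/-! ### Shear automorphisms. -/

section Shear

variable {n : ℕ} {ρ : ℝ} [hρ : Fact (0 < ρ)] {E : Type*} [NormedField E] [IsUltrametricDist E]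

instance {σ : Type*} : Fact (∀ s : σ, (0 : ℝ) < (fun _ => 1) s) := ⟨fun _ => one_pos⟩

/-- The images `x_k + b_k T ^ N_k` of the variables under a shear; the first variable `T` is
fixed. -/
def shear (ρ : ℝ) (b : Fin n → E) (N : Fin n → ℕ) :
    Fin (n + 1) → Tate (consRadius ρ fun _ : Fin n => (1 : ℝ)) E :=
  Fin.cases (X 0) fun k => X k.succ + const _ E (b k) * X 0 ^ N k

omit hρ in
lemma coe_shear_zero (b : Fin n → E) (N : Fin n → ℕ) :
    (shear ρ b N 0).1 = MvPowerSeries.X 0 := rfl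

omit hρ in
lemma coe_shear_succ (b : Fin n → E) (N : Fin n → ℕ) (k : Fin n) :
    (shear ρ b N k.succ).1 =
      MvPowerSeries.X k.succ + MvPowerSeries.C (b k) * MvPowerSeries.X 0 ^ N k := by
  simp only [shear, Fin.cases_succ, Subring.coe_add, Subring.coe_mul, SubmonoidClass.coe_pow]
  rfl

omit hρ in
lemma hasSubst_shear (b : Fin n → E) {N : Fin n → ℕ} (hN : ∀ k, N k ≠ 0) :
    MvPowerSeries.HasSubst fun s => (shear ρ b N s).1 := by
  refine MvPowerSeries.hasSubst_of_constantCoeff_zero fun s => ?_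
  refine Fin.cases ?_ (fun k => ?_) s
  · rw [coe_shear_zero, MvPowerSeries.constantCoeff_X]
  · rw [coe_shear_succ, map_add, map_mul, map_pow, MvPowerSeries.constantCoeff_X,
      MvPowerSeries.constantCoeff_X, zero_pow (hN k), mul_zero, add_zero]

lemma norm_shear_le {b : Fin n → E} {N : Fin n → ℕ} (hb : ∀ k, ‖b k‖ * ρ ^ N k ≤ 1)
    (s : Fin (n + 1)) : ‖shear ρ b N s‖ ≤ consRadius ρ (fun _ => 1) s := by
  have : NormOneClass (Tate (consRadius ρ fun _ : Fin n => (1 : ℝ)) E) :=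
    NormMulClass.toNormOneClass
  refine Fin.cases (norm_X_le 0) (fun k => ?_) s
  change ‖X k.succ + const _ E (b k) * X 0 ^ N k‖ ≤ 1
  refine (IsUltrametricDist.norm_add_le_max _ _).trans (max_le (norm_X_le k.succ) ?_)
  rw [norm_mul, norm_const, norm_pow]
  exact (mul_le_mul_of_nonneg_left (pow_le_pow_left₀ (norm_nonneg _) (norm_X_le 0) _)
    (norm_nonneg _)).trans (hb k)

/-- Since `T` is fixed, the added multiples of powers of `T` cancel. -/
lemma substHom_shear_neg {b : Fin n → E} {N : Fin n → ℕ} (hN : ∀ k, N k ≠ 0)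
    (hb : ∀ k, ‖b k‖ * ρ ^ N k ≤ 1) (hb' : ∀ k, ‖(-b) k‖ * ρ ^ N k ≤ 1)
    (f : Tate (consRadius ρ fun _ : Fin n => (1 : ℝ)) E) :
    substHom (hasSubst_shear (-b) hN) (norm_shear_le hb')
      (substHom (hasSubst_shear b hN) (norm_shear_le hb) f) = f := by
  refine Subtype.ext ?_
  rw [coe_substHom, coe_substHom, MvPowerSeries.subst_comp_subst_apply (hasSubst_shear b hN)
    (hasSubst_shear (-b) hN)]
  have hX : (fun s => MvPowerSeries.subst (fun s => (shear ρ (-b) N s).1) (shear ρ b N s).1) =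
      (MvPowerSeries.X : Fin (n + 1) → MvPowerSeries (Fin (n + 1)) E) := by
    have h' := hasSubst_shear (ρ := ρ) (-b) hN
    have h0 : MvPowerSeries.subst (fun s => (shear ρ (-b) N s).1)
        (MvPowerSeries.X 0 : MvPowerSeries (Fin (n + 1)) E) = MvPowerSeries.X 0 := by
      rw [MvPowerSeries.subst_X h', coe_shear_zero]
    funext s
    refine Fin.cases ?_ (fun k => ?_) s
    · rw [coe_shear_zero, h0]
    · rw [coe_shear_succ, MvPowerSeries.subst_add h', MvPowerSeries.subst_mul h',
        MvPowerSeries.subst_pow h', h0, MvPowerSeries.subst_C, MvPowerSeries.subst_X h',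
        coe_shear_succ, Pi.neg_apply, map_neg]
      ring
  rw [hX, MvPowerSeries.subst_self]
  rfl

/-- The automorphism `x_k ↦ x_k + b_k T ^ N_k`. -/
def shearEquiv {b : Fin n → E} {N : Fin n → ℕ} (hN : ∀ k, N k ≠ 0)
    (hb : ∀ k, ‖b k‖ * ρ ^ N k ≤ 1) :
    Tate (consRadius ρ fun _ : Fin n => (1 : ℝ)) E ≃+*
      Tate (consRadius ρ fun _ : Fin n => (1 : ℝ)) E :=
  have hb' : ∀ k, ‖(-b) k‖ * ρ ^ N k ≤ 1 := fun k => by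
    rw [Pi.neg_apply, norm_neg]; exact hb k
  RingEquiv.ofRingHom (substHom (hasSubst_shear b hN) (norm_shear_le hb))
    (substHom (hasSubst_shear (-b) hN) (norm_shear_le hb'))
    (RingHom.ext fun f => by
      have := substHom_shear_neg (b := -b) hN hb' (by simpa only [neg_neg] using hb) f
      simp only [neg_neg] at this
      exact this)
    (RingHom.ext fun f => substHom_shear_neg hN hb hb' f)

end Shear

end Tate

end RestrictedSeries

namespace RestrictedSeries

open Filter Topology

namespace Tate

/-! ### Leading terms under shears, and reduction to distinguished series. -/

section Lead

variable {n : ℕ} {E : Type*} [NormedField E]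

/-- The series `g` is a polynomial in the first variable of degree at most `L` whose
coefficient of degree `L` is the constant `u`. -/
def HasLead (g : MvPowerSeries (Fin (n + 1)) E) (L : ℕ) (u : E) : Prop :=
  ∃ P : Polynomial (MvPowerSeries (Fin n) E), MvPowerSeries.finSuccEquiv E n g = P ∧
    P.natDegree ≤ L ∧ P.coeff L = MvPowerSeries.C u

lemma HasLead.coeff_eq {g : MvPowerSeries (Fin (n + 1)) E} {L : ℕ} {u : E} (h : HasLead g L u)
    {e : Fin (n + 1) →₀ ℕ} (he : L ≤ e 0) :
    MvPowerSeries.coeff e g = if e = Finsupp.single 0 L then u else 0 := by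
  classical
  obtain ⟨P, hP, hdeg, hlead⟩ := h
  have hsingle : (Finsupp.single 0 L : Fin (n + 1) →₀ ℕ) = Finsupp.cons L 0 := by
    ext i; refine Fin.cases ?_ (fun j => ?_) i <;> simp
  rw [← Finsupp.cons_tail e, ← MvPowerSeries.coeff_coeff_finSuccEquiv, hP, Polynomial.coeff_coe,
    hsingle]
  simp only [Finsupp.cons_injective2.eq_iff]
  rcases he.eq_or_lt with h | h
  · rw [← h, hlead, MvPowerSeries.coeff_C]
    simp
  · rw [Polynomial.coeff_eq_zero_of_natDegree_lt (hdeg.trans_lt h), map_zero,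
      if_neg (by rintro ⟨h', -⟩; omega)]

lemma HasLead.one : HasLead (1 : MvPowerSeries (Fin (n + 1)) E) 0 1 :=
  ⟨1, by simp, by simp, by simp⟩

lemma HasLead.mul {g g' : MvPowerSeries (Fin (n + 1)) E} {L L' : ℕ} {u u' : E}
    (h : HasLead g L u) (h' : HasLead g' L' u') : HasLead (g * g') (L + L') (u * u') := by
  obtain ⟨P, hP, hdeg, hlead⟩ := h
  obtain ⟨P', hP', hdeg', hlead'⟩ := h'
  refine ⟨P * P', by rw [map_mul, hP, hP', Polynomial.coe_mul],
    Polynomial.natDegree_mul_le_of_le hdeg hdeg', ?_⟩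
  rw [Polynomial.coeff_mul_add_eq_of_natDegree_le hdeg hdeg', hlead, hlead', map_mul]

lemma HasLead.pow {g : MvPowerSeries (Fin (n + 1)) E} {L : ℕ} {u : E}
    (h : HasLead g L u) (k : ℕ) : HasLead (g ^ k) (k * L) (u ^ k) := by
  induction k with
  | zero => simpa using HasLead.one
  | succ k ih => simpa only [pow_succ, Nat.succ_mul] using ih.mul h

lemma HasLead.prod {ι : Type*} (s : Finset ι) {g : ι → MvPowerSeries (Fin (n + 1)) E} {L : ι → ℕ}
    {u : ι → E} (h : ∀ i, HasLead (g i) (L i) (u i)) :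
    HasLead (∏ i ∈ s, g i) (∑ i ∈ s, L i) (∏ i ∈ s, u i) := by
  classical
  induction s using Finset.induction_on with
  | empty => simpa using HasLead.one
  | insert i s hi ih =>
    rw [Finset.prod_insert hi, Finset.sum_insert hi, Finset.prod_insert hi]
    exact (h i).mul ih

variable [IsUltrametricDist E] {ρ : ℝ}

lemma hasLead_shear (b : Fin n → E) {N : Fin n → ℕ} (hN : ∀ k, N k ≠ 0) (s : Fin (n + 1)) :
    HasLead (shear ρ b N s).1 ((Fin.cons 1 N : Fin (n + 1) → ℕ) s)
      ((Fin.cons 1 b : Fin (n + 1) → E) s) := by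
  refine Fin.cases ?_ (fun k => ?_) s
  · refine ⟨Polynomial.X, ?_, Polynomial.natDegree_X_le, by simp⟩
    rw [coe_shear_zero, MvPowerSeries.finSuccEquiv_X_zero, Polynomial.coe_X]
  · refine ⟨Polynomial.C (MvPowerSeries.X k) +
      Polynomial.C (MvPowerSeries.C (b k)) * Polynomial.X ^ N k, ?_, ?_, ?_⟩
    · simp [coe_shear_succ]
    · rw [Fin.cons_succ]
      exact Polynomial.natDegree_add_le_of_degree_le ((Polynomial.natDegree_C _).trans_le
        (Nat.zero_le _)) (Polynomial.natDegree_C_mul_X_pow_le _ _)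
    · rw [Fin.cons_succ, Fin.cons_succ, Polynomial.coeff_add, Polynomial.coeff_C,
        if_neg (hN k), Polynomial.coeff_C_mul_X_pow, if_pos rfl, zero_add]

/-- The degree in `T` of the image of a monomial under a shear. -/
def shearDegree (N : Fin n → ℕ) (d : Fin (n + 1) →₀ ℕ) : ℕ :=
  ∑ s, d s * (Fin.cons 1 N : Fin (n + 1) → ℕ) s

lemma hasLead_monomialIn_shear (b : Fin n → E) {N : Fin n → ℕ} (hN : ∀ k, N k ≠ 0)
    (d : Fin (n + 1) →₀ ℕ) : HasLead (monomialIn (shear ρ b N) d).1 (shearDegree N d)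
      (∏ s, ((Fin.cons 1 b : Fin (n + 1) → E) s) ^ d s) := by
  rw [coe_monomialIn, Finsupp.prod_fintype _ _ (by simp)]
  exact HasLead.prod _ fun s => (hasLead_shear b hN s).pow (d s)

/-- With `N k = Q ^ (k + 1)` the degree is the number whose base-`Q` digits are the entries of `d`.
-/
lemma shearDegree_injOn (Q : ℕ) (hQ : 1 < Q) {d d' : Fin (n + 1) →₀ ℕ} (hd : ∀ i, d i < Q)
    (hd' : ∀ i, d' i < Q)
    (h : shearDegree (fun k : Fin n => Q ^ ((k : ℕ) + 1)) d =
      shearDegree (fun k : Fin n => Q ^ ((k : ℕ) + 1)) d') : d = d' := by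
  have key : ∀ d : Fin (n + 1) →₀ ℕ, shearDegree (fun k : Fin n => Q ^ ((k : ℕ) + 1)) d =
      Nat.ofDigits Q (List.ofFn d) := fun d => by
    rw [Nat.ofDigits_eq_sum_mapIdx, shearDegree, List.mapIdx_eq_ofFn, List.sum_ofFn]
    refine Fintype.sum_equiv (finCongr (by simp)) _ _ fun s => ?_
    refine Fin.cases ?_ (fun k => ?_) s <;> simp
  rw [key, key] at h
  have := Nat.ofDigits_inj_of_len_eq hQ (by simp) ((List.forall_mem_ofFn_iff).mpr hd)
    ((List.forall_mem_ofFn_iff).mpr hd') h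
  exact DFunLike.coe_injective (List.ofFn_injective this)

end Lead

/-- Every nonzero restricted series becomes distinguished in the first variable, up to a unit,
after an automorphism. -/
theorem exists_equiv_isDistinguished {n : ℕ} {ρ : ℝ} [hρ : Fact (0 < ρ)] {E : Type*}
    [NormedField E] [IsUltrametricDist E] [CompleteSpace E] {m : ℕ} (hm : m ≠ 0) {β : E}
    (hβ : ‖β‖ * ρ ^ m = 1) {f : Tate (consRadius ρ fun _ : Fin n => (1 : ℝ)) E} (hf : f ≠ 0) :
    ∃ σ : Tate (consRadius ρ fun _ : Fin n => (1 : ℝ)) E ≃+*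
        Tate (consRadius ρ fun _ : Fin n => (1 : ℝ)) E,
      ∃ u : DiscAlgebra (Tate (fun _ : Fin n => (1 : ℝ)) E) ρ, ∃ s, IsUnit u ∧
        DiscAlgebra.IsDistinguished (u * discAlgebraEquiv (σ f)) s := by
  classical
  have hf0 : 0 < ‖f‖ := norm_pos_iff.mpr hf
  set S := (f.finite_le_term hf0).toFinset
  have hmemS : ∀ t, t ∈ S ↔ f.term t = ‖f‖ := fun t => by
    simp only [S, Set.Finite.mem_toFinset, Set.mem_ofPred_eq]
    exact ⟨fun h => le_antisymm (f.term_le_norm t) h, fun h => h.ge⟩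
  have hnotS : ∀ t, t ∉ S → f.term t < ‖f‖ := fun t ht =>
    lt_of_le_of_ne (f.term_le_norm t) fun h => ht ((hmemS t).mpr h)
  have hS : S.Nonempty := by
    obtain ⟨t, ht⟩ := f.exists_term_eq_norm
    exact ⟨t, (hmemS t).mpr ht⟩
  set M := S.sup fun t => Finset.univ.sup t
  have hM : ∀ t ∈ S, ∀ i, t i ≤ M := fun t ht i =>
    (Finset.le_sup (f := t) (Finset.mem_univ i)).trans
      (Finset.le_sup (f := fun t : Fin (n + 1) →₀ ℕ => Finset.univ.sup t) ht)
  -- The factor `M + 2` makes `Q` a base larger than `1` and than every exponent in `S`; the factor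
  -- `m` makes `m` divide each `N k`, so that a power of `β` compensates `ρ ^ N k` exactly.
  set Q := m * (M + 2)
  have hQM : M + 2 ≤ Q := Nat.le_mul_of_pos_left _ (Nat.pos_of_ne_zero hm)
  set N : Fin n → ℕ := fun k => Q ^ ((k : ℕ) + 1)
  have hN : ∀ k, N k ≠ 0 := fun k => pow_ne_zero _ (by omega)
  set b : Fin n → E := fun k => β ^ (N k / m)
  have hdvd : ∀ k, m ∣ N k := fun k => (Dvd.intro _ rfl).trans (dvd_pow_self Q (Nat.succ_ne_zero _))
  have hb : ∀ k, ‖b k‖ * ρ ^ N k = 1 := fun k => by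
    have : ρ ^ N k = (ρ ^ m) ^ (N k / m) := by rw [← pow_mul, Nat.mul_div_cancel' (hdvd k)]
    rw [this, norm_pow, ← mul_pow, hβ, one_pow]
  set L := shearDegree N
  set u : (Fin (n + 1) →₀ ℕ) → E := fun d => ∏ s, ((Fin.cons 1 b : Fin (n + 1) → E) s) ^ d s
  -- The leading term `u d * T ^ L d` of the image of a monomial keeps the full weight of that
  -- monomial.
  have hu : ∀ d, ‖u d‖ * ρ ^ L d = weight (consRadius ρ fun _ => 1) d := fun d => by
    simp only [u, L, shearDegree]
    rw [norm_prod, ← Finset.prod_pow_eq_pow_sum, ← Finset.prod_mul_distrib, weight,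
      Finsupp.prod_fintype _ _ (by simp)]
    refine Finset.prod_congr rfl fun s _ => ?_
    rw [norm_pow, mul_comm (d s), pow_mul, ← mul_pow]
    congr 1
    refine Fin.cases (by simp) (fun k => ?_) s
    simpa using hb k
  have hlead : ∀ d, HasLead (monomialIn (shear ρ b N) d).1 (L d) (u d) :=
    hasLead_monomialIn_shear b hN
  -- This `t` is the dominant monomial of largest sheared degree. By injectivity of `L` on `S`, no
  -- other dominant monomial contributes to `T ^ L t`, and none contributes to other exponents of
  -- `T`-degree at least `L t`.
  obtain ⟨t, htS, htmax⟩ := Finset.exists_max_image S L hS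
  have hsubst := hasSubst_shear (ρ := ρ) b hN
  have hle := norm_shear_le (ρ := ρ) (b := b) (N := N) fun k => (hb k).le
  set g := shearEquiv hN (fun k => (hb k).le) f
  have hg : g.1 = MvPowerSeries.subst (fun s => (shear ρ b N s).1) f.1 := coe_substHom hsubst hle f
  have hgle : ‖g‖ ≤ ‖f‖ := by
    refine norm_le_of fun e => le_of_forall_gt fun C hC => ?_
    rw [term, hg]
    exact term_subst_lt hsubst (hf0.trans hC) fun d =>
      (norm_coeff_mul_term_monomialIn_le hle f d e).trans_lt ((f.term_le_norm d).trans_lt hC)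
  have hzero : ∀ d ∈ S, ∀ e : Fin (n + 1) →₀ ℕ, L t ≤ e 0 → (e ≠ Finsupp.single 0 (L t) ∨ d ≠ t) →
      (monomialIn (shear ρ b N) d).term e = 0 := by
    intro d hd e he hne
    have hLd : L d ≤ e 0 := (htmax d hd).trans he
    rw [term, (hlead d).coeff_eq hLd, if_neg, norm_zero, zero_mul]
    intro h
    have h0 : e 0 = L d := by rw [h]; simp
    have hLL : L d = L t := le_antisymm (htmax d hd) (h0 ▸ he)
    rcases hne with hne | hne
    · exact hne (hLL ▸ h)
    · exact hne (shearDegree_injOn Q (by omega) (fun i => (hM d hd i).trans_lt (by omega))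
        (fun i => (hM t htS i).trans_lt (by omega)) hLL)
  have hlt : ∀ e, L t ≤ e 0 → e ≠ Finsupp.single 0 (L t) → g.term e < ‖f‖ := by
    intro e he hne
    rw [term, hg]
    refine term_subst_lt hsubst hf0 fun d => ?_
    by_cases hd : d ∈ S
    · rw [hzero d hd e he (Or.inl hne), mul_zero]
      exact hf0
    · exact (norm_coeff_mul_term_monomialIn_le hle f d e).trans_lt (hnotS d hd)
  have heq : g.term (Finsupp.single 0 (L t)) = ‖f‖ := by
    set x := MvPowerSeries.coeff t f.1
    set e : Fin (n + 1) →₀ ℕ := Finsupp.single 0 (L t)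
    have hw : weight (consRadius ρ fun _ : Fin n => (1 : ℝ)) e = ρ ^ L t := weight_single _ _ _
    have he0 : e 0 = L t := by simp [e]
    -- Splitting off the monomial at `t` isolates the only contribution of norm `‖f‖` to the
    -- coefficient of `T ^ L t`.
    let f₁ : Tate (consRadius ρ fun _ : Fin n => (1 : ℝ)) E :=
      ⟨MvPowerSeries.monomial t x, MvPowerSeries.isRestricted_monomial _ t x⟩
    have h1 : ‖MvPowerSeries.coeff e (MvPowerSeries.subst (fun s => (shear ρ b N s).1)
        (f - f₁).1)‖ * weight (consRadius ρ fun _ : Fin n => (1 : ℝ)) e < ‖f‖ := by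
      refine term_subst_lt hsubst hf0 fun d => ?_
      have hc : MvPowerSeries.coeff d (f - f₁).1 =
          if d = t then 0 else MvPowerSeries.coeff d f.1 := by
        rw [AddSubgroupClass.coe_sub, map_sub]
        change _ - MvPowerSeries.coeff d (MvPowerSeries.monomial t x) = _
        rw [MvPowerSeries.coeff_monomial]
        split_ifs with h
        · rw [h, sub_self]
        · rw [sub_zero]
      rw [hc]
      split_ifs with h
      · simpa using hf0
      · by_cases hd : d ∈ S
        · rw [hzero d hd e he0.ge (Or.inr h), mul_zero]
          exact hf0
        · exact (norm_coeff_mul_term_monomialIn_le hle f d e).trans_lt (hnotS d hd)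
    have h2 : MvPowerSeries.coeff e (MvPowerSeries.subst (fun s => (shear ρ b N s).1)
        f₁.1) = x * u t := by
      change MvPowerSeries.coeff e (MvPowerSeries.subst (fun s => (shear ρ b N s).1)
        (MvPowerSeries.monomial t x)) = _
      rw [MvPowerSeries.subst_monomial hsubst, ← coe_monomialIn, MvPowerSeries.algebraMap_apply,
        MvPowerSeries.coeff_C_mul, (hlead t).coeff_eq he0.ge, if_pos rfl]
      rfl
    have h3 : ‖x * u t‖ * weight (consRadius ρ fun _ : Fin n => (1 : ℝ)) e = ‖f‖ := by
      rw [norm_mul, hw, mul_assoc, hu, ← (hmemS t).mp htS]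
      rfl
    have hwpos : 0 < weight (consRadius ρ fun _ : Fin n => (1 : ℝ)) e := by
      rw [hw]; exact pow_pos hρ.out _
    have h4 : MvPowerSeries.coeff e g.1 = MvPowerSeries.coeff e (MvPowerSeries.subst
        (fun s => (shear ρ b N s).1) (f - f₁).1) + x * u t := by
      rw [hg, ← h2, ← map_add, ← MvPowerSeries.subst_add hsubst, ← Subring.coe_add, sub_add_cancel]
    have h5 : ‖MvPowerSeries.coeff e (MvPowerSeries.subst (fun s => (shear ρ b N s).1)
        (f - f₁).1)‖ < ‖x * u t‖ := lt_of_mul_lt_mul_right (h3.symm ▸ h1) hwpos.le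
    rw [term, h4, IsUltrametricDist.norm_add_eq_max_of_norm_ne_norm h5.ne, max_eq_right h5.le, h3]
  have hgf : ‖g‖ = ‖f‖ := le_antisymm hgle (heq ▸ term_le_norm _ _)
  have hg0 : g ≠ 0 := by
    rw [← norm_pos_iff, hgf]; exact hf0
  obtain ⟨v, hv, hdist⟩ := exists_isDistinguished hg0 (heq.trans hgf.symm)
    fun e he hne => hgf ▸ hlt e he hne
  exact ⟨shearEquiv hN fun k => (hb k).le, v, L t, hv, hdist⟩

end Tate

end RestrictedSeries

/-! ### Rings of restricted power series are Noetherian and factorial -/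

namespace RestrictedSeries

/-- A nonzero ideal contains some `f ≠ 0`; it is finitely generated because its image modulo `f` and
its intersection with `(f)`, which is `(f)`, are. -/
lemma isNoetherianRing_of_quotient {B : Type*} [CommRing B]
    (h : ∀ f : B, f ≠ 0 → IsNoetherianRing (B ⧸ Ideal.span {f})) : IsNoetherianRing B := by
  rw [isNoetherianRing_iff_ideal_fg]
  intro I
  by_cases hI : I = ⊥
  · rw [hI]; exact Submodule.fg_bot
  obtain ⟨f, hfI, hf⟩ := Submodule.exists_mem_ne_zero_of_ne_bot hI
  have := h f hf
  refine Submodule.fg_of_fg_map_of_fg_inf_ker (Algebra.linearMap B (B ⧸ Ideal.span {f})) ?_ ?_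
  · have h1 : (I.map (Ideal.Quotient.mk (Ideal.span {f}))).FG := IsNoetherian.noetherian _
    have h2 := Submodule.FG.restrictScalars_of_surjective (R := B) h1 Ideal.Quotient.mk_surjective
    have e : Submodule.map (Algebra.linearMap B (B ⧸ Ideal.span {f})) I = Submodule.restrictScalars B
        (Ideal.map (Ideal.Quotient.mk (Ideal.span {f})) I) := by
      ext x
      rw [Submodule.restrictScalars_mem, Ideal.mem_map_iff_of_surjective _
        Ideal.Quotient.mk_surjective]
      rfl
    rwa [e]
  · have e : LinearMap.ker (Algebra.linearMap B (B ⧸ Ideal.span {f})) = Ideal.span {f} :=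
      Ideal.mk_ker
    rw [e, inf_eq_right.mpr ((Ideal.span_singleton_le_iff_mem _).mpr hfI)]
    exact Submodule.fg_span_singleton f

namespace Tate

variable {E : Type*} [NormedField E] [IsUltrametricDist E]

instance {σ : Type*} (c : σ → ℝ) : IsDomain (Tate c E) :=
  have : NoZeroDivisors (Tate c E) := inferInstance
  NoZeroDivisors.to_isDomain _

lemma const_bijective (c : Fin 0 → ℝ) : Function.Bijective (const c E) := by
  refine ⟨(const c E).injective, fun f => ⟨MvPowerSeries.coeff 0 f.1, Subtype.ext ?_⟩⟩
  ext t
  rw [Subsingleton.elim t 0]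
  exact MvPowerSeries.coeff_zero_C _

variable [CompleteSpace E]

/-- The induction step: a ring of restricted series in `n + 1` variables of polyradius
`(ρ, 1, …, 1)` with `ρ` in the divisible closure of the value group is Noetherian and factorial if
the ring in `n` variables of polyradius `(1, …, 1)` is. -/
lemma isNoetherianRing_and_ufm_succ {n : ℕ} {ρ : ℝ} [hρ : Fact (0 < ρ)] {m : ℕ} (hm : m ≠ 0)
    {β : E} (hβ : ‖β‖ * ρ ^ m = 1) [IsNoetherianRing (Tate (fun _ : Fin n => (1 : ℝ)) E)]
    [UniqueFactorizationMonoid (Tate (fun _ : Fin n => (1 : ℝ)) E)] :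
    IsNoetherianRing (Tate (consRadius ρ fun _ : Fin n => (1 : ℝ)) E) ∧
      UniqueFactorizationMonoid (Tate (consRadius ρ fun _ : Fin n => (1 : ℝ)) E) := by
  constructor
  · refine isNoetherianRing_of_quotient fun f hf => ?_
    obtain ⟨σ, u, s, hu, hdist⟩ := exists_equiv_isDistinguished hm hβ hf
    have := hdist.isNoetherianRing_quotient
    rw [Ideal.span_singleton_mul_left_unit hu] at this
    refine isNoetherianRing_of_ringEquiv _ (Ideal.quotientEquiv (Ideal.span {f})
      (Ideal.span {discAlgebraEquiv (σ f)}) (σ.trans discAlgebraEquiv) ?_).symm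
    rw [Ideal.map_span, Set.image_singleton]
    rfl
  · refine UniqueFactorizationMonoid.of_exists_prime_factors fun f hf => ?_
    obtain ⟨σ, u, s, hu, hdist⟩ := exists_equiv_isDistinguished hm hβ hf
    obtain ⟨t, ht, hassoc⟩ := hdist.exists_prime_factors
    set Ψ := (σ.trans discAlgebraEquiv)
    refine ⟨t.map Ψ.symm, fun x hx => ?_, ?_⟩
    · obtain ⟨y, hy, rfl⟩ := Multiset.mem_map.mp hx
      exact (MulEquiv.prime_iff Ψ.symm.toMulEquiv).mpr (ht y hy)
    · have h1 : Associated t.prod (Ψ f) := hassoc.trans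
        (associated_unit_mul_left (Ψ f) u hu)
      have h2 : Associated (Ψ.symm t.prod) (Ψ.symm (Ψ f)) := h1.map Ψ.symm.toMonoidHom
      rwa [map_multiset_prod, Ψ.symm_apply_apply] at h2

/-- The induction starts from the field `E`; at radius `1` the condition on the radius holds with `β
= 1` and `m = 1`. -/
lemma isNoetherianRing_and_ufm (n : ℕ) :
    IsNoetherianRing (Tate (fun _ : Fin n => (1 : ℝ)) E) ∧
      UniqueFactorizationMonoid (Tate (fun _ : Fin n => (1 : ℝ)) E) := by
  induction n with
  | zero =>
    let e := RingEquiv.ofBijective (const (fun _ : Fin 0 => (1 : ℝ)) E) (const_bijective _)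
    exact ⟨isNoetherianRing_of_ringEquiv _ e,
      e.toMulEquiv.uniqueFactorizationMonoid inferInstance⟩
  | succ n ih =>
    have := ih.1
    have := ih.2
    have hc : (fun _ : Fin (n + 1) => (1 : ℝ)) = consRadius 1 fun _ : Fin n => (1 : ℝ) :=
      funext (Fin.cases rfl fun _ => rfl)
    have : Fact ((0 : ℝ) < 1) := ⟨one_pos⟩
    rw [hc]
    exact isNoetherianRing_and_ufm_succ one_ne_zero (β := (1 : E)) (by simp)

end Tate

end RestrictedSeries

/-! ### The rings `ℋ_{A,i}` are Noetherian and factorial. -/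

namespace CylChar

open RestrictedSeries

section Level

variable (p : ℕ) [hp : Fact p.Prime] (E : Type*) [NormedField E] [IsUltrametricDist E] (d i : ℕ)

instance : Fact (0 < levelRadius p i) := ⟨levelRadius_pos p i⟩

instance : Fact (∀ s, 0 < levelPolyradius p d i s) :=
  ⟨(Fact.out : ∀ s, 0 < consRadius (levelRadius p i) (fun _ : Fin d => (1 : ℝ)) s)⟩

/-- A power of the radius lies in the value group of `E`; this is what allows shears that rescale
`T` isometrically, with `β = p⁻¹`. -/
lemma levelRadius_pow : levelRadius p i ^ (p ^ i * (p - 1)) = (p : ℝ)⁻¹ := by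
  have h1 : (1 : ℝ) < p := by exact_mod_cast hp.out.one_lt
  have h2 : (p : ℝ) - 1 ≠ 0 := by linarith
  rw [levelRadius, ← Real.rpow_natCast, ← Real.rpow_mul (by positivity), ← Real.rpow_neg_one]
  congr 1
  push_cast [Nat.cast_sub hp.out.one_le]
  field_simp

instance : NormedCommRing (HALevel p E d i) :=
  inferInstanceAs (NormedCommRing (Tate (levelPolyradius p d i) E))

instance : NormMulClass (HALevel p E d i) :=
  inferInstanceAs (NormMulClass (Tate (levelPolyradius p d i) E))

instance [CompleteSpace E] : CompleteSpace (HALevel p E d i) :=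
  inferInstanceAs (CompleteSpace (Tate (levelPolyradius p d i) E))

instance : IsDomain (HALevel p E d i) :=
  inferInstanceAs (IsDomain (Tate (levelPolyradius p d i) E))

variable [NormedAlgebra ℚ_[p] E]

omit [IsUltrametricDist E] in
include p in
lemma completeSpace_of_finite [FiniteDimensional ℚ_[p] E] : CompleteSpace E :=
  FiniteDimensional.complete ℚ_[p] E

omit [IsUltrametricDist E] in
lemma norm_natCast_prime : ‖(p : E)‖ = (p : ℝ)⁻¹ := by
  rw [← map_natCast (algebraMap ℚ_[p] E), norm_algebraMap', Padic.norm_p]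

variable [FiniteDimensional ℚ_[p] E]

lemma isNoetherianRing_and_ufm_HALevel :
    IsNoetherianRing (HALevel p E d i) ∧ UniqueFactorizationMonoid (HALevel p E d i) := by
  have := completeSpace_of_finite p E
  have := (Tate.isNoetherianRing_and_ufm (E := E) d).1
  have := (Tate.isNoetherianRing_and_ufm (E := E) d).2
  have hp0 : (p : ℝ) ≠ 0 := by exact_mod_cast hp.out.ne_zero
  refine Tate.isNoetherianRing_and_ufm_succ (n := d) (ρ := levelRadius p i)
    (m := p ^ i * (p - 1)) (β := (p : E)⁻¹) ?_ ?_
  · exact mul_ne_zero (pow_ne_zero _ hp.out.ne_zero) (Nat.sub_pos_of_lt hp.out.one_lt).ne'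
  · rw [norm_inv, norm_natCast_prime p E, levelRadius_pow, inv_inv, mul_inv_cancel₀ hp0]

instance : IsNoetherianRing (HALevel p E d i) := (isNoetherianRing_and_ufm_HALevel p E d i).1

instance : UniqueFactorizationMonoid (HALevel p E d i) :=
  (isNoetherianRing_and_ufm_HALevel p E d i).2

end Level

end CylChar

/-! ### The characteristic ideal of the cokernel of a square matrix -/

namespace CylChar

/-- The length of the cokernel of an injective endomorphism of a finite free module over a
principal ideal domain is the order of its determinant. -/
lemma length_quotient_range_eq_ord_det {L : Type*} [CommRing L] [IsDomain L]
    [IsPrincipalIdealRing L] {ι : Type*} [Fintype ι] {V : Type*} [AddCommGroup V] [Module L V]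
    (b : Module.Basis ι L V) (f : V →ₗ[L] V) (hf : Function.Injective f) :
    Module.length L (V ⧸ LinearMap.range f) = Ring.ord L (LinearMap.det f) := by
  classical
  have : Module.Free L V := Module.Free.of_basis b
  have : Module.Finite L V := Module.Finite.of_basis b
  have h : Module.finrank L (LinearMap.range f) = Module.finrank L V :=
    LinearMap.finrank_range_of_inj hf
  rw [(Submodule.quotientEquivPiSpan _ b h).length_eq, Module.length_pi_of_fintype]
  set a := Submodule.smithNormalFormCoeffs b h
  set b' := Submodule.smithNormalFormTopBasis b h
  -- From the basis `c` to `b'` the map `f` is diagonal with the Smith coefficients `a`. So `f` is a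
  -- diagonal map after an automorphism, which changes the determinant only by a unit.
  let c := (Submodule.smithNormalFormBotBasis b h).map (LinearEquiv.ofInjective f hf).symm
  have hc : ∀ i, f (c i) = a i • b' i := fun i => by
    have h1 : (LinearEquiv.ofInjective f hf) (c i) = Submodule.smithNormalFormBotBasis b h i := by
      simp [c]
    have h2 := congrArg Subtype.val h1
    rw [Submodule.smithNormalFormBotBasis_def] at h2
    exact h2
  let u := c.equiv b' (Equiv.refl ι)
  let D : V →ₗ[L] V := Matrix.toLin b' b' (Matrix.diagonal a)
  have hD : f = D ∘ₗ u.toLinearMap := c.ext fun i => by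
    rw [hc, LinearMap.comp_apply, LinearEquiv.coe_coe, Module.Basis.equiv_apply, Equiv.refl_apply]
    simp only [D]
    rw [Matrix.toLin_self, Finset.sum_eq_single i]
    · rw [Matrix.diagonal_apply_eq]
    · intro j _ hj
      rw [Matrix.diagonal_apply_ne _ hj, zero_smul]
    · simp
  have ha : ∀ i, a i ∈ nonZeroDivisors L := fun i =>
    mem_nonZeroDivisors_of_ne_zero (Submodule.smithNormalFormCoeffs_ne_zero b h i)
  have hprod : ∀ s : Finset ι, Ring.ord L (∏ i ∈ s, a i) = ∑ i ∈ s, Ring.ord L (a i) := fun s => by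
    induction s using Finset.induction_on with
    | empty => simp
    | insert i s hi ih =>
      rw [Finset.prod_insert hi, Finset.sum_insert hi, Ring.ord_mul' L (ha i), ih]
  have hdet : LinearMap.det f = (∏ i, a i) * LinearMap.det u.toLinearMap := by
    rw [hD, LinearMap.det_comp, LinearMap.det_toLin, Matrix.det_diagonal]
  rw [hdet, Ring.ord_mul_of_isUnit_right (LinearEquiv.isUnit_det' u), hprod]
  rfl

variable {R : Type*} [CommRing R] [IsDomain R] [IsNoetherianRing R]
  [UniqueFactorizationMonoid R]

instance (𝔭 : HeightOnePrime R) : IsDomain (Localization.AtPrime 𝔭.1.asIdeal) :=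
  IsLocalization.isDomain_localization 𝔭.1.asIdeal.primeCompl_le_nonZeroDivisors

instance (𝔭 : HeightOnePrime R) : IsNoetherianRing (Localization.AtPrime 𝔭.1.asIdeal) :=
  IsLocalization.isNoetherianRing 𝔭.1.asIdeal.primeCompl _ inferInstance

omit [IsNoetherianRing R] in
lemma HeightOnePrime.exists_eq_span (𝔭 : HeightOnePrime R) :
    ∃ q : R, Prime q ∧ 𝔭.1.asIdeal = Ideal.span {q} := by
  have hp := UniqueFactorizationMonoid.isPrincipal_of_height_eq_one 𝔭.2
  obtain ⟨q, hq⟩ := hp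
  have hq' : 𝔭.1.asIdeal = Ideal.span {q} := hq
  have hne : 𝔭.1.asIdeal ≠ ⊥ := Ideal.ne_bot_of_height_eq_one 𝔭.2
  refine ⟨q, ?_, hq'⟩
  have hq0 : q ≠ 0 := fun h => hne (by rw [hq', h]; simp)
  rw [← Ideal.span_singleton_prime hq0, ← hq']
  exact 𝔭.1.isPrime

omit [IsDomain R] [IsNoetherianRing R] [UniqueFactorizationMonoid R] in
lemma HeightOnePrime.maximalIdeal_eq_span (𝔭 : HeightOnePrime R) {q : R}
    (hq : 𝔭.1.asIdeal = Ideal.span {q}) :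
    IsLocalRing.maximalIdeal (Localization.AtPrime 𝔭.1.asIdeal) =
      Ideal.span {algebraMap R (Localization.AtPrime 𝔭.1.asIdeal) q} := by
  have h := congrArg (Ideal.map (algebraMap R (Localization.AtPrime 𝔭.1.asIdeal))) hq
  rw [Localization.AtPrime.map_eq_maximalIdeal, Ideal.map_span, Set.image_singleton] at h
  exact h

/-- Factoriality makes `𝔭` principal, and a Noetherian local domain with principal maximal ideal is
a principal ideal ring. -/
instance (𝔭 : HeightOnePrime R) : IsPrincipalIdealRing (Localization.AtPrime 𝔭.1.asIdeal) := by
  obtain ⟨q, -, hq⟩ := 𝔭.exists_eq_span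
  refine ((tfae_of_isNoetherianRing_of_isLocalRing_of_isDomain
    (Localization.AtPrime 𝔭.1.asIdeal)).out 0 4).mpr ?_
  exact ⟨_, 𝔭.maximalIdeal_eq_span hq⟩

omit [IsNoetherianRing R] [UniqueFactorizationMonoid R] in
lemma HeightOnePrime.algebraMap_ne_zero (𝔭 : HeightOnePrime R) {x : R} (hx : x ≠ 0) :
    algebraMap R (Localization.AtPrime 𝔭.1.asIdeal) x ≠ 0 := fun h =>
  hx (IsLocalization.injective _ 𝔭.1.asIdeal.primeCompl_le_nonZeroDivisors
    (h.trans (map_zero _).symm))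

/-- The order of `x` at a height-one prime. -/
def ordAt (𝔭 : HeightOnePrime R) (x : R) : ℕ∞ :=
  Ring.ord (Localization.AtPrime 𝔭.1.asIdeal) (algebraMap R _ x)

/-- Localisation commutes with cokernels, so the length is that of the cokernel of `B` over the
local ring, where Smith normal form applies. -/
lemma charExponent_quotient_range {n : ℕ} (B : Matrix (Fin n) (Fin n) R) (hB : B.det ≠ 0)
    (𝔭 : HeightOnePrime R) :
    charExponent ((Fin n → R) ⧸ LinearMap.range B.mulVecLin) 𝔭 = (ordAt 𝔭 B.det).toNat := by
  set S := 𝔭.1.asIdeal.primeCompl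
  set L := Localization.AtPrime 𝔭.1.asIdeal
  let g : (Fin n → R) →ₗ[R] (Fin n → L) :=
    LinearMap.pi fun k => Algebra.linearMap R L ∘ₗ LinearMap.proj k
  set N := LinearMap.range B.mulVecLin
  let B' : Matrix (Fin n) (Fin n) L := B.map (algebraMap R L)
  have hN : N.localized' L S g = LinearMap.range B'.mulVecLin := by
    rw [Submodule.localized'_eq_span]
    refine le_antisymm (Submodule.span_le.mpr ?_) ?_
    · rintro _ ⟨_, ⟨v, rfl⟩, rfl⟩
      refine ⟨g v, ?_⟩
      ext k
      simp [g, B', Matrix.mulVec, dotProduct]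
    · rw [Matrix.range_mulVecLin, Submodule.span_le]
      rintro _ ⟨j, rfl⟩
      refine Submodule.subset_span ⟨B.mulVecLin (Pi.single j 1), ⟨_, rfl⟩, ?_⟩
      ext k
      simp [g, B']
  let e := IsLocalizedModule.linearEquiv S
    (LocalizedModule.mkLinearMap S ((Fin n → R) ⧸ N)) (N.toLocalizedQuotient' L S g)
  have hdet : LinearMap.det B'.mulVecLin = algebraMap R L B.det := by
    rw [← Matrix.toLin'_apply', LinearMap.det_toLin', RingHom.map_det]
    rfl
  have hinj : Function.Injective B'.mulVecLin := by
    rw [← LinearMap.ker_eq_bot, LinearMap.ker_eq_bot']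
    intro v hv
    refine Matrix.eq_zero_of_mulVec_eq_zero (M := B') ?_ hv
    rw [← LinearMap.det_toLin', Matrix.toLin'_apply', hdet]
    exact 𝔭.algebraMap_ne_zero hB
  unfold charExponent ordAt
  rw [(e.extendScalarsOfIsLocalization S L).length_eq, hN,
    length_quotient_range_eq_ord_det (Pi.basisFun L (Fin n)) _ hinj, hdet]

lemma ordAt_ne_top (𝔭 : HeightOnePrime R) {x : R} (hx : x ≠ 0) : ordAt 𝔭 x ≠ ⊤ :=
  Ring.ord_ne_top (mem_nonZeroDivisors_of_ne_zero (𝔭.algebraMap_ne_zero hx))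

omit [IsNoetherianRing R] [UniqueFactorizationMonoid R] in
lemma ordAt_mul (𝔭 : HeightOnePrime R) {x y : R} (hx : x ≠ 0) :
    ordAt 𝔭 (x * y) = ordAt 𝔭 x + ordAt 𝔭 y := by
  unfold ordAt
  rw [map_mul]
  exact Ring.ord_mul' _ (mem_nonZeroDivisors_of_ne_zero (𝔭.algebraMap_ne_zero hx))

lemma toNat_ordAt_mul (𝔭 : HeightOnePrime R) {x y : R} (hx : x ≠ 0) (hy : y ≠ 0) :
    (ordAt 𝔭 (x * y)).toNat = (ordAt 𝔭 x).toNat + (ordAt 𝔭 y).toNat := by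
  rw [ordAt_mul 𝔭 hx, ENat.toNat_add (ordAt_ne_top 𝔭 hx) (ordAt_ne_top 𝔭 hy)]

omit [IsDomain R] [IsNoetherianRing R] [UniqueFactorizationMonoid R] in
lemma ordAt_of_notMem (𝔭 : HeightOnePrime R) {x : R} (hx : x ∉ 𝔭.1.asIdeal) : ordAt 𝔭 x = 0 :=
  Ring.ord_of_isUnit (IsLocalization.map_units (M := 𝔭.1.asIdeal.primeCompl) _ ⟨x, hx⟩)

lemma ordAt_of_eq_span (𝔭 : HeightOnePrime R) {q : R} (hq0 : q ≠ 0)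
    (hq : 𝔭.1.asIdeal = Ideal.span {q}) : ordAt 𝔭 q = 1 := by
  refine Ring.ord_of_irreducible (Prime.irreducible ?_)
  rw [← Ideal.span_singleton_prime (𝔭.algebraMap_ne_zero hq0), ← 𝔭.maximalIdeal_eq_span hq]
  infer_instance

/-- A nonzero element of a Noetherian factorial domain is the product of the height-one primes
with the orders as exponents. -/
theorem finprod_pow_ordAt (x : R) : x ≠ 0 →
    (Function.HasFiniteMulSupport fun 𝔭 : HeightOnePrime R => 𝔭.1.asIdeal ^ (ordAt 𝔭 x).toNat) ∧
    ∏ᶠ 𝔭 : HeightOnePrime R, 𝔭.1.asIdeal ^ (ordAt 𝔭 x).toNat = Ideal.span {x} := by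
  induction x using UniqueFactorizationMonoid.induction_on_prime with
  | h₁ => exact fun h => absurd rfl h
  | h₂ u hu =>
    intro _
    have h : (fun 𝔭 : HeightOnePrime R => 𝔭.1.asIdeal ^ (ordAt 𝔭 u).toNat) = fun _ => 1 := by
      funext 𝔭
      rw [ordAt_of_notMem 𝔭 fun h => 𝔭.1.isPrime.ne_top (Ideal.eq_top_of_isUnit_mem _ h hu)]
      exact pow_zero _
    rw [h, Ideal.span_singleton_eq_top.mpr hu]
    exact ⟨Function.hasFiniteMulSupport_one, finprod_one.trans Ideal.one_eq_top⟩
  | h₃ a q ha hq ih =>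
    intro _
    obtain ⟨hfin, hprod⟩ := ih ha
    have hqp : (Ideal.span {q}).IsPrime := (Ideal.span_singleton_prime hq.ne_zero).mpr hq
    let 𝔮 : HeightOnePrime R := ⟨⟨Ideal.span {q}, hqp⟩,
      Ideal.height_span_singleton_eq_one_of_mem_nonZeroDivisors
        (mem_nonZeroDivisors_of_ne_zero hq.ne_zero) hq.not_isUnit⟩
    have h : (fun 𝔭 : HeightOnePrime R => 𝔭.1.asIdeal ^ (ordAt 𝔭 (q * a)).toNat) = fun 𝔭 =>
        𝔭.1.asIdeal ^ (ordAt 𝔭 q).toNat * 𝔭.1.asIdeal ^ (ordAt 𝔭 a).toNat := by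
      funext 𝔭
      rw [toNat_ordAt_mul 𝔭 hq.ne_zero ha, pow_add]
    -- If `q` lies in `𝔭 = (r)`, the primes `r` and `q` are associated and `𝔭 = 𝔮`.
    have hone : ∀ 𝔭 : HeightOnePrime R, 𝔭 ≠ 𝔮 → 𝔭.1.asIdeal ^ (ordAt 𝔭 q).toNat = 1 := by
      intro 𝔭 hne
      rw [ordAt_of_notMem, ENat.toNat_zero, pow_zero]
      intro hmem
      obtain ⟨r, hr, hr'⟩ := 𝔭.exists_eq_span
      rw [hr', Ideal.mem_span_singleton] at hmem
      have hass : Associated r q := hr.associated_of_dvd hq hmem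
      exact hne (Subtype.ext (PrimeSpectrum.ext
        (hr'.trans (Ideal.span_singleton_eq_span_singleton.mpr hass))))
    have hfin' : Function.HasFiniteMulSupport
        fun 𝔭 : HeightOnePrime R => 𝔭.1.asIdeal ^ (ordAt 𝔭 q).toNat :=
      (Set.finite_singleton 𝔮).subset fun 𝔭 h𝔭 => by_contra fun hne => h𝔭 (hone 𝔭 hne)
    rw [h]
    refine ⟨hfin'.mul hfin, ?_⟩
    rw [finprod_mul_distrib hfin' hfin, hprod, finprod_eq_single _ 𝔮 hone,
      ordAt_of_eq_span 𝔮 hq.ne_zero rfl, ENat.toNat_one, pow_one,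
      Ideal.span_singleton_mul_span_singleton]

/-- The characteristic ideal of the cokernel of a square matrix over a Noetherian factorial domain
is generated by the determinant. -/
theorem charIdeal_quotient_range {n : ℕ} (B : Matrix (Fin n) (Fin n) R) (hB : B.det ≠ 0) :
    charIdeal R ((Fin n → R) ⧸ LinearMap.range B.mulVecLin) = Ideal.span {B.det} := by
  rw [← (finprod_pow_ordAt B.det hB).2]
  exact finprod_congr fun 𝔭 => by rw [charExponent_quotient_range B hB]

omit [IsDomain R] [IsNoetherianRing R] [UniqueFactorizationMonoid R] in
lemma charIdeal_congr {M N : Type*} [AddCommGroup M] [Module R M] [AddCommGroup N] [Module R N]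
    (e : M ≃ₗ[R] N) : charIdeal R M = charIdeal R N := by
  refine finprod_congr fun 𝔭 => ?_
  have h : charExponent M 𝔭 = charExponent N 𝔭 := by
    unfold charExponent
    let S := 𝔭.1.asIdeal.primeCompl
    let e' := IsLocalizedModule.linearEquiv S (LocalizedModule.mkLinearMap S M)
      (LocalizedModule.mkLinearMap S N ∘ₗ e.toLinearMap)
    rw [(e'.extendScalarsOfIsLocalization S (Localization.AtPrime 𝔭.1.asIdeal)).length_eq]
  rw [h]

end CylChar

/-! ### Submodules of finitely generated Banach modules are closed -/

namespace BanachModule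

open Filter Topology

section Closed

attribute [local instance] Matrix.linftyOpNormedRing in
-- The bound makes every row sum of norms at most `m / (m + 1) < 1`, so the geometric series
-- converges in the row-sum operator norm.
lemma isUnit_one_sub_matrix {R : Type*} [NormedCommRing R] [CompleteSpace R] {m : ℕ}
    (t : Matrix (Fin m) (Fin m) R) (ht : ∀ a b, ‖t a b‖ ≤ 1 / (m + 1)) : IsUnit (1 - t) := by
  have h : CompleteSpace (Fin m → Fin m → R) := inferInstance
  have : @CompleteSpace (Matrix (Fin m) (Fin m) R)
    Matrix.linftyOpNormedRing.toMetricSpace.toPseudoMetricSpace.toUniformSpace := h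
  refine isUnit_one_sub_of_norm_lt_one ?_
  rw [← coe_nnnorm, ← NNReal.coe_one, NNReal.coe_lt_coe, Matrix.linfty_opNNNorm_def,
    Finset.sup_lt_iff one_pos]
  intro a _
  rw [← NNReal.coe_lt_coe, NNReal.coe_sum, NNReal.coe_one]
  calc ∑ b, ‖t a b‖ ≤ ∑ _b : Fin m, 1 / ((m : ℝ) + 1) := Finset.sum_le_sum fun b _ => ht a b
    _ = m / (m + 1) := by
      rw [Finset.sum_const, Finset.card_univ, Fintype.card_fin, nsmul_eq_mul, mul_one_div]
    _ < 1 := by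
      rw [div_lt_one (by positivity)]
      linarith

variable (𝕜 : Type*) {R M : Type*} [NontriviallyNormedField 𝕜] [NormedCommRing R]
  [CompleteSpace R] [NormedAlgebra 𝕜 R] [NormedAddCommGroup M] [CompleteSpace M] [Module R M]
  [IsBoundedSMul R M] [NormedSpace 𝕜 M] [IsScalarTower 𝕜 R M] [IsNoetherian R M]

include 𝕜 in
-- A topological Nakayama argument. The closure is finitely generated, say by `g`; approximate `g`
-- by `y` in `L`. By the open mapping theorem the error is `t g` with a matrix `t` of small entries,
-- so `y = (1 - t) g`. As `1 - t` is invertible, `g` already lies in `L`.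
theorem isClosed_submodule (L : Submodule R M) : IsClosed (L : Set M) := by
  have hcl : IsClosed (L.topologicalClosure : Set M) := L.isClosed_topologicalClosure
  suffices h : L.topologicalClosure ≤ L by
    rwa [← le_antisymm L.le_topologicalClosure h] at hcl
  set L' := L.topologicalClosure with hL'
  have : CompleteSpace L' := hcl.completeSpace_coe
  obtain ⟨m, g, hg⟩ := Submodule.fg_iff_exists_fin_generating_family.mp
    (Module.Finite.fg_top (R := R) (M := L'))
  let f₀ : (Fin m → R) →ₗ[R] L' := Fintype.linearCombination R g
  have hf₀ : Continuous f₀ := by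
    change Continuous fun r : Fin m → R => Fintype.linearCombination R g r
    simp only [Fintype.linearCombination_apply]
    fun_prop
  let f : (Fin m → R) →L[𝕜] L' := ⟨f₀.restrictScalars 𝕜, hf₀⟩
  have hsurj : Function.Surjective f := by
    have h : LinearMap.range f₀ = ⊤ := by rw [Fintype.range_linearCombination, hg]
    exact (LinearMap.range_eq_top (f := f₀)).mp h
  obtain ⟨C, hC, hlift⟩ := f.exists_preimage_norm_le hsurj
  have hε : 0 < 1 / ((m : ℝ) + 1) / C := by positivity
  have happrox : ∀ a, ∃ y ∈ L, ‖(g a : M) - y‖ < 1 / ((m : ℝ) + 1) / C := fun a => by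
    obtain ⟨y, hy, hd⟩ := Metric.mem_closure_iff.mp (g a).2 _ hε
    exact ⟨y, hy, by rwa [← dist_eq_norm]⟩
  choose y hyL hy using happrox
  let y' : Fin m → L' := fun a => ⟨y a, L.le_topologicalClosure (hyL a)⟩
  choose t ht htn using fun a => hlift (g a - y' a)
  have hunit : IsUnit (1 - Matrix.of t) := by
    refine isUnit_one_sub_matrix _ fun a b => ?_
    calc ‖t a b‖ ≤ ‖t a‖ := norm_le_pi_norm _ _
      _ ≤ C * ‖g a - y' a‖ := htn a
      _ ≤ C * (1 / ((m : ℝ) + 1) / C) := mul_le_mul_of_nonneg_left (hy a).le hC.le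
      _ = _ := by field_simp
  obtain ⟨s, hs⟩ := hunit.exists_left_inv
  have hyg : ∀ a, ∑ b, (1 - Matrix.of t) a b • (g b : M) = y a := by
    intro a
    have h1 : ∑ b, t a b • (g b : M) = g a - y a := by
      have h2 := congrArg Subtype.val (ht a)
      rw [← show ((g a - y' a : L') : M) = g a - y a from rfl, ← h2]
      change _ = ((Fintype.linearCombination R g (t a) : L') : M)
      rw [Fintype.linearCombination_apply, Submodule.coe_sum]
      rfl
    simp only [Matrix.sub_apply, Matrix.of_apply, sub_smul, Finset.sum_sub_distrib, h1,
      Matrix.one_apply, ite_smul, one_smul, zero_smul, Finset.sum_ite_eq, Finset.mem_univ, if_true]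
    abel
  have hgL : ∀ a, (g a : M) ∈ L := by
    intro a
    have h1 : (g a : M) = ∑ b, s a b • y b := by
      simp_rw [← hyg, Finset.smul_sum, smul_smul]
      rw [Finset.sum_comm]
      simp_rw [← Finset.sum_smul, ← Matrix.mul_apply, hs, Matrix.one_apply, ite_smul, one_smul,
        zero_smul, Finset.sum_ite_eq, Finset.mem_univ, if_true]
    rw [h1]
    exact Submodule.sum_mem _ fun b _ => L.smul_mem _ (hyL b)
  intro x hx
  obtain ⟨r, hr⟩ := hsurj ⟨x, hx⟩
  have h1 : x = ∑ b, r b • (g b : M) := by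
    have h2 := congrArg Subtype.val hr
    rw [← show ((⟨x, hx⟩ : L') : M) = x from rfl, ← h2]
    change ((Fintype.linearCombination R g r : L') : M) = _
    rw [Fintype.linearCombination_apply, Submodule.coe_sum]
    rfl
  rw [h1]
  exact Submodule.sum_mem _ fun b _ => L.smul_mem _ (hgL b)

end Closed

/-! ### Mittag-Leffler for inverse sequences of Banach modules -/

section MittagLeffler

variable {X : ℕ → Type*} [∀ i, NormedAddCommGroup (X i)] (f : ∀ i, X (i + 1) →+ X i)

/-- The images in the `X i` with `i ≤ k` of an element of `X k`; the other components are zero. -/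
def descend : ∀ k, X k → ∀ i, X i
  | 0, x => Function.update 0 0 x
  | k + 1, x => Function.update (descend k (f k x)) (k + 1) x

lemma descend_self (k : ℕ) (x : X k) : descend f k x k = x := by
  cases k <;> simp [descend]

lemma descend_succ_of_le {k i : ℕ} (h : i ≤ k) (x : X (k + 1)) :
    descend f (k + 1) x i = descend f k (f k x) i := by
  rw [descend, Function.update_of_ne (by omega)]

lemma map_descend (k : ℕ) : ∀ (x : X k) {i : ℕ}, i < k →
    f i (descend f k x (i + 1)) = descend f k x i := by
  induction k with
  | zero => intro x i h; omega
  | succ k ih =>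
    intro x i h
    rw [descend_succ_of_le f (Nat.le_of_lt_succ h)]
    rcases Nat.lt_succ_iff_lt_or_eq.mp h with h' | rfl
    · rw [descend_succ_of_le f h', ih _ h']
    · rw [descend_self, descend_self]

lemma descend_sub (k : ℕ) : ∀ (x y : X k) (i : ℕ),
    descend f k (x - y) i = descend f k x i - descend f k y i := by
  induction k with
  | zero =>
    intro x y i
    by_cases h : i = 0
    · subst h; simp [descend]
    · simp [descend, Function.update_of_ne h]
  | succ k ih =>
    intro x y i
    by_cases h : i = k + 1
    · subst h; simp [descend]
    · simp [descend, Function.update_of_ne h, ih]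

/-- The maximum of the norms of the images of an element of `X k` in the `X i` with `i ≤ k`. -/
def descendNorm : ∀ k, X k → ℝ
  | 0, x => ‖x‖
  | k + 1, x => max ‖x‖ (descendNorm k (f k x))

lemma norm_descend_le (k : ℕ) : ∀ (x : X k) {i : ℕ}, i ≤ k →
    ‖descend f k x i‖ ≤ descendNorm f k x := by
  induction k with
  | zero =>
    intro x i h
    obtain rfl : i = 0 := by omega
    simp [descend, descendNorm]
  | succ k ih =>
    intro x i h
    rcases Nat.le_succ_iff.mp h with h' | rfl
    · rw [descend_succ_of_le f h']
      exact (ih _ h').trans (le_max_right _ _)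
    · rw [descend_self]
      exact le_max_left _ _

lemma descendNorm_zero (k : ℕ) : descendNorm f k 0 = 0 := by
  induction k with
  | zero => exact norm_zero
  | succ k ih => rw [descendNorm, map_zero, ih, norm_zero, max_self]

variable {f}

lemma continuous_descendNorm (hf : ∀ i, Continuous (f i)) (k : ℕ) :
    Continuous (descendNorm f k) := by
  induction k with
  | zero => exact continuous_norm
  | succ k ih => exact continuous_norm.max (ih.comp (hf k))

/-- If the transition maps of an inverse sequence of complete normed groups are continuous with
dense image, then every element of `X i` can be approximated by compatible families. -/
theorem exists_compatible_near [∀ i, CompleteSpace (X i)] (hf : ∀ i, Continuous (f i))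
    (hdense : ∀ i, DenseRange (f i)) (i : ℕ) (x : X i) {ε : ℝ} (hε : 0 < ε) :
    ∃ z : ∀ i, X i, (∀ i, f i (z (i + 1)) = z i) ∧ ‖z i - x‖ ≤ ε := by
  -- Closeness is measured by `descendNorm`, so one choice at level `k + 1` controls the images at
  -- all levels up to `k`.
  have hstep : ∀ (k : ℕ) (y : X k) (η : ℝ), 0 < η →
      ∃ y' : X (k + 1), descendNorm f k (f k y' - y) < η := by
    intro k y η hη
    have hopen : IsOpen {w : X k | descendNorm f k (w - y) < η} :=
      isOpen_lt ((continuous_descendNorm hf k).comp (continuous_id.sub continuous_const))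
        continuous_const
    obtain ⟨y', hy'⟩ := (hdense k).exists_mem_open hopen ⟨y, by
      change descendNorm f k (y - y) < η
      rwa [sub_self, descendNorm_zero]⟩
    exact ⟨y', hy'⟩
  choose! next hnext using hstep
  let u : ∀ j, X (i + j) := fun j => Nat.rec x (fun j y => next (i + j) y (ε / 2 / 2 ^ j)) j
  have hu : ∀ j, descendNorm f (i + j) (f (i + j) (u (j + 1)) - u j) < ε / 2 / 2 ^ j := fun j =>
    hnext (i + j) (u j) _ (by positivity)
  have hdist : ∀ j l, l ≤ i + j →
      ‖descend f (i + (j + 1)) (u (j + 1)) l - descend f (i + j) (u j) l‖ ≤ ε / 2 / 2 ^ j := by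
    intro j l hl
    rw [show descend f (i + (j + 1)) (u (j + 1)) l = descend f (i + j) (f (i + j) (u (j + 1))) l from
      descend_succ_of_le f hl _, ← descend_sub]
    exact (norm_descend_le f _ _ hl).trans (hu j).le
  have hcauchy : ∀ l, ∃ z, Tendsto (fun j => descend f (i + j) (u j) l) atTop (𝓝 z) := by
    intro l
    -- The shift by `l` ensures that level `l` has been reached; before that the component is the
    -- default value `0`.
    have h : CauchySeq fun j => descend f (i + (j + l)) (u (j + l)) l := by
      refine cauchySeq_of_le_geometric_two (C := ε / 2 ^ l) fun j => ?_
      rw [dist_comm, dist_eq_norm]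
      have h1 := hdist (j + l) l (by omega)
      rw [show j + 1 + l = j + l + 1 by omega]
      refine h1.trans (le_of_eq ?_)
      rw [pow_add]
      field_simp
    obtain ⟨z, hz⟩ := cauchySeq_tendsto_of_complete h
    exact ⟨z, (tendsto_add_atTop_iff_nat l).mp hz⟩
  choose z hz using hcauchy
  refine ⟨z, fun l => ?_, ?_⟩
  · refine tendsto_nhds_unique (((hf l).tendsto _).comp (hz (l + 1))) ((hz l).congr' ?_)
    filter_upwards [eventually_ge_atTop (l + 1)] with j hj
    exact (map_descend f (i + j) (u j) (by omega)).symm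
  · have h := dist_le_of_le_geometric_two_of_tendsto₀ (C := ε)
      (f := fun j => descend f (i + j) (u j) i) (fun j => by
        rw [dist_comm, dist_eq_norm]
        exact hdist j i (by omega)) (hz i)
    rw [dist_comm, dist_eq_norm] at h
    rwa [show descend f (i + 0) (u 0) i = x from descend_self f i x] at h

end MittagLeffler

/-! ### Semilinear maps with dense range -/

section Dense

variable {A B X Y : Type*} [NormedCommRing A] [NormedCommRing B] {σ : A →+* B}
  [NormedAddCommGroup X] [Module A X] [NormedAddCommGroup Y] [Module B Y] [IsBoundedSMul B Y]

/-- The closure of the range is stable under `σ A`, hence by continuity under `B`; it is a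
`B`-submodule containing the generators. -/
lemma denseRange_of_span_eq_top (hσ : DenseRange σ) (f : X →ₛₗ[σ] Y)
    (hf : Submodule.span B (Set.range f) = ⊤) : DenseRange f := by
  let L : AddSubgroup Y := (AddMonoidHom.range f.toAddMonoidHom).topologicalClosure
  have hL : (L : Set Y) = closure (Set.range f) := rfl
  have hsmul : ∀ (b : B) (y : Y), y ∈ L → b • y ∈ L := by
    intro b y hy
    have h1 : ∀ x : X, b • f x ∈ L := by
      intro x
      have hc : IsClosed {b : B | b • f x ∈ L} :=
        (AddSubgroup.isClosed_topologicalClosure _).preimage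
          (continuous_id.smul continuous_const)
      refine hσ.induction_on (p := fun b => b • f x ∈ L) b hc fun a => ?_
      rw [← map_smulₛₗ]
      exact subset_closure ⟨_, rfl⟩
    have hc : IsClosed {y : Y | b • y ∈ L} :=
      (AddSubgroup.isClosed_topologicalClosure _).preimage (continuous_const_smul b)
    have h2 : closure (Set.range f) ⊆ {y : Y | b • y ∈ L} :=
      closure_minimal (by rintro _ ⟨x, rfl⟩; exact h1 x) hc
    exact h2 hy
  let L' : Submodule B Y := { L with smul_mem' := hsmul }
  have htop : (⊤ : Submodule B Y) ≤ L' := by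
    rw [← hf, Submodule.span_le]
    exact subset_closure
  intro y
  exact htop (Submodule.mem_top : y ∈ ⊤)

end Dense

end BanachModule

/-! ### Base change along a ring homomorphism -/

namespace CylChar

open RestrictedSeries BanachModule

section BaseChange

variable {A B : Type*} [CommRing A] [CommRing B] {σ : A →+* B} {M N : Type*}
  [AddCommGroup M] [Module A M] [AddCommGroup N] [Module B N]

/-- The coordinatewise application of a ring homomorphism to vectors. -/
def mapVec (σ : A →+* B) (n : ℕ) : (Fin n → A) →ₛₗ[σ] (Fin n → B) where
  toFun x a := σ (x a)
  map_add' _ _ := funext fun _ => map_add σ _ _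
  map_smul' _ _ := funext fun _ => map_mul σ _ _

lemma mapVec_apply (σ : A →+* B) {n : ℕ} (x : Fin n → A) (a : Fin n) :
    mapVec σ n x a = σ (x a) := rfl

lemma mapVec_single (σ : A →+* B) {n : ℕ} (a : Fin n) :
    mapVec σ n (Pi.single a 1) = Pi.single a 1 := by
  funext b
  rw [mapVec_apply]
  by_cases h : b = a
  · subst h; simp
  · simp [Pi.single_eq_of_ne h]

lemma mapVec_mulVec (σ : A →+* B) {n : ℕ} (C : Matrix (Fin n) (Fin n) A) (x : Fin n → A) :
    mapVec σ n (C.mulVec x) = (C.map σ).mulVec (mapVec σ n x) := by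
  funext a
  rw [mapVec_apply]
  exact RingHom.map_mulVec σ C x a

lemma IsBaseChangeAlong.span_range {g : M →ₛₗ[σ] N} (hg : IsBaseChangeAlong g) :
    Submodule.span B (Set.range g) = ⊤ := by
  let _ : Algebra A B := σ.toAlgebra
  let _ : Module A N := Module.compHom N σ
  have _ : IsScalarTower A B N := ⟨fun r s n => mul_smul (σ r) s n⟩
  let g' : M →ₗ[A] N :=
    { toFun := g, map_add' := g.map_add, map_smul' := fun r m => g.map_smulₛₗ r m }
  have hg' : IsBaseChange B g' := hg
  refine eq_top_iff.mpr fun x _ => ?_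
  induction x using hg'.inductionOn with
  | zero => exact zero_mem _
  | tmul m => exact Submodule.subset_span ⟨m, rfl⟩
  | smul s n h => exact Submodule.smul_mem _ _ (h trivial)
  | add x y hx hy => exact add_mem (hx trivial) (hy trivial)

/-- If `N` is the base change of `M` and `M` is the quotient of a free module `A ^ n`, then the
kernel of the induced map `B ^ n → N` is generated by the kernel of `A ^ n → M`. -/
lemma IsBaseChangeAlong.ker_le_span {g : M →ₛₗ[σ] N} (hg : IsBaseChangeAlong g) {n : ℕ}
    {f : (Fin n → A) →ₗ[A] M} (hf : Function.Surjective f) {θ : (Fin n → B) →ₗ[B] N}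
    (h : ∀ x, θ (mapVec σ n x) = g (f x)) :
    LinearMap.ker θ ≤ Submodule.span B (mapVec σ n '' (LinearMap.ker f : Set (Fin n → A))) := by
  set L := Submodule.span B (mapVec σ n '' (LinearMap.ker f : Set (Fin n → A)))
  let _ : Algebra A B := σ.toAlgebra
  let _ : Module A N := Module.compHom N σ
  have _ : IsScalarTower A B N := ⟨fun r s n => mul_smul (σ r) s n⟩
  let g' : M →ₗ[A] N :=
    { toFun := g, map_add' := g.map_add, map_smul' := fun r m => g.map_smulₛₗ r m }
  have hg' : IsBaseChange B g' := hg
  let v : (Fin n → A) →ₗ[A] ((Fin n → B) ⧸ L) :=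
    { toFun := fun x => L.mkQ (mapVec σ n x)
      map_add' := fun x y => by rw [map_add, map_add]
      map_smul' := fun r x => by
        rw [map_smulₛₗ, map_smul]
        exact algebraMap_smul B r (L.mkQ (mapVec σ n x)) }
  have hv : LinearMap.ker f ≤ LinearMap.ker v := fun x hx => by
    rw [LinearMap.mem_ker]
    exact (Submodule.Quotient.mk_eq_zero L).mpr (Submodule.subset_span ⟨x, hx, rfl⟩)
  -- By base change `l` extends to a map from `N` whose composite with `θ` is the projection modulo
  -- `L`; so `ker θ` lies in `L`.
  let l : M →ₗ[A] ((Fin n → B) ⧸ L) :=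
    ((LinearMap.ker f).liftQ v hv) ∘ₗ (f.quotKerEquivOfSurjective hf).symm.toLinearMap
  have hl : ∀ x, l (f x) = L.mkQ (mapVec σ n x) := fun x => by
    have h1 : (f.quotKerEquivOfSurjective hf).symm (f x) = (LinearMap.ker f).mkQ x := by
      rw [LinearEquiv.symm_apply_eq]
      rfl
    change (LinearMap.ker f).liftQ v hv ((f.quotKerEquivOfSurjective hf).symm (f x)) = _
    rw [h1]
    rfl
  have hcomp : hg'.lift l ∘ₗ θ = L.mkQ := by
    refine (Pi.basisFun B (Fin n)).ext fun a => ?_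
    rw [Pi.basisFun_apply, ← mapVec_single σ a, LinearMap.comp_apply, h, ← hl]
    exact hg'.lift_eq l _
  intro y hy
  rw [LinearMap.mem_ker] at hy
  have h1 := LinearMap.congr_fun hcomp y
  rw [LinearMap.comp_apply, hy, map_zero] at h1
  exact (Submodule.Quotient.mk_eq_zero L).mp h1.symm

end BaseChange

/-! ### Topology of the distribution algebras -/

section Topology

variable (p : ℕ) [hp : Fact p.Prime] (E : Type*) [NormedField E] [IsUltrametricDist E] (d i : ℕ)

instance [NormedAlgebra ℚ_[p] E] : NormedAlgebra ℚ_[p] (HALevel p E d i) where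
  __ := ((Tate.const (levelPolyradius p d i) E).comp (algebraMap ℚ_[p] E)).toAlgebra
  norm_smul_le r x := by
    refine (norm_mul_le (Tate.const (levelPolyradius p d i) E (algebraMap ℚ_[p] E r)) x).trans ?_
    rw [Tate.norm_const, norm_algebraMap']
    exact le_rfl

variable {p E d i} in
lemma HALevel.coe_restrict (x : HALevel p E d (i + 1)) :
    (HALevel.restrict p E d i x : MvPowerSeries (Fin (d + 1)) E) = x :=
  Subring.coe_inclusion (HALevel_succ_le p E d i) x

omit hp in
variable {p E d i} in
lemma HA.coe_restrict (x : HA p E d) :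
    (HA.restrict p E d i x : MvPowerSeries (Fin (d + 1)) E) = x :=
  Subring.coe_inclusion (iInf_le _ i) x

lemma levelPolyradius_le_succ (s : Fin (d + 1)) :
    levelPolyradius p d i s ≤ levelPolyradius p d (i + 1) s := by
  induction s using Fin.cases with
  | zero => exact levelRadius_le_succ p i
  | succ s => exact le_rfl

lemma weight_levelPolyradius_le_succ (t : Fin (d + 1) →₀ ℕ) :
    weight (levelPolyradius p d i) t ≤ weight (levelPolyradius p d (i + 1)) t := by
  have h0 : ∀ s, 0 < levelPolyradius p d i s := Fact.out
  exact Finset.prod_le_prod (fun s _ => pow_nonneg (h0 s).le _) fun s _ =>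
    pow_le_pow_left₀ (h0 s).le (levelPolyradius_le_succ p d i s) _

lemma norm_restrict_le (x : HALevel p E d (i + 1)) : ‖HALevel.restrict p E d i x‖ ≤ ‖x‖ := by
  refine Tate.norm_le_of (c := levelPolyradius p d i) fun t => ?_
  have h1 : Tate.term (c := levelPolyradius p d i) (HALevel.restrict p E d i x) t ≤
      Tate.term (c := levelPolyradius p d (i + 1)) x t := by
    unfold Tate.term
    rw [HALevel.coe_restrict]
    exact mul_le_mul_of_nonneg_left (weight_levelPolyradius_le_succ p d i t) (norm_nonneg _)
  exact h1.trans (Tate.term_le_norm (c := levelPolyradius p d (i + 1)) x t)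

lemma continuous_restrict : Continuous (HALevel.restrict p E d i) :=
  AddMonoidHomClass.continuous_of_bound _ 1 fun x => by
    rw [one_mul]
    exact norm_restrict_le p E d i x

/-- The polynomials are dense in the algebras `ℋ_{A,i}`. -/
lemma denseRange_HA_restrict : DenseRange (HA.restrict p E d i) := by
  classical
  intro f
  rw [Metric.mem_closure_range_iff]
  intro ε hε
  have hfin := Tate.finite_le_term (c := levelPolyradius p d i) f hε
  -- Keeping only the finitely many terms of size at least `ε` leaves a polynomial, which converges
  -- at every level.
  let g : MvPowerSeries (Fin (d + 1)) E :=
    fun t => if ε ≤ Tate.term (c := levelPolyradius p d i) f t then MvPowerSeries.coeff t f.1 else 0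
  have hg : g ∈ HA p E d := by
    refine Subring.mem_iInf.mpr fun j => ?_
    refine tendsto_nhds_of_eventually_eq ?_
    filter_upwards [hfin.compl_mem_cofinite] with t ht
    have h1 : MvPowerSeries.coeff t g = 0 := if_neg ht
    rw [h1, norm_zero, zero_mul]
  refine ⟨⟨g, hg⟩, ?_⟩
  rw [dist_eq_norm]
  refine Tate.norm_lt_of (c := levelPolyradius p d i) fun t => ?_
  have h1 : MvPowerSeries.coeff t (f - HA.restrict p E d i ⟨g, hg⟩).1 =
      MvPowerSeries.coeff t f.1 - g t := by
    rw [AddSubgroupClass.coe_sub, HA.coe_restrict, map_sub]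
    rfl
  unfold Tate.term
  rw [h1]
  by_cases h : ε ≤ Tate.term (c := levelPolyradius p d i) f t
  · rw [show g t = MvPowerSeries.coeff t f.1 from if_pos h, sub_self, norm_zero, zero_mul]
    exact hε
  · rw [show g t = 0 from if_neg h, sub_zero]
    exact not_le.mp h

lemma denseRange_restrict : DenseRange (HALevel.restrict p E d i) :=
  (denseRange_HA_restrict p E d i).mono (by
    rintro _ ⟨x, rfl⟩
    exact ⟨HA.restrict p E d (i + 1) x, rfl⟩)

end Topology

lemma continuous_mapVec {A B : Type*} [NormedCommRing A] [NormedCommRing B] {σ : A →+* B}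
    (hσ : Continuous σ) (n : ℕ) : Continuous (mapVec σ n) :=
  continuous_pi fun a => hσ.comp (continuous_apply a)

/-- Semilinear maps on quotients of finite free modules are continuous. -/
lemma continuous_of_quotient {A B : Type*} [NormedCommRing A] [NormedCommRing B] {σ : A →+* B}
    (hσ : Continuous σ) {n : ℕ} (K : Submodule A (Fin n → A)) {Y : Type*} [NormedAddCommGroup Y]
    [Module B Y] [IsBoundedSMul B Y] (f : ((Fin n → A) ⧸ K) →ₛₗ[σ] Y) : Continuous f := by
  rw [K.isQuotientMap_mkQ.continuous_iff]
  have h : f ∘ K.mkQ = fun x : Fin n → A => ∑ a, σ (x a) • f (K.mkQ (Pi.single a 1)) := by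
    funext x
    have hx : x = ∑ a, x a • (Pi.single a 1 : Fin n → A) := by
      simpa using ((Pi.basisFun A (Fin n)).sum_repr x).symm
    conv_lhs => rw [hx]
    simp only [Function.comp_apply, map_sum, map_smul, map_smulₛₗ]
  rw [h]
  exact continuous_finsetSum _ fun a _ => (hσ.comp (continuous_apply a)).smul continuous_const

/-! ### The levels of a coadmissible cokernel -/

section Levels

variable {p : ℕ} [Fact p.Prime] {E : Type*} [NormedField E] [IsUltrametricDist E]
  [NormedAlgebra ℚ_[p] E] [FiniteDimensional ℚ_[p] E] {d : ℕ}
  {M : Type*} [AddCommGroup M] [Module (HA p E d) M]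

/-- A coadmissible module generates its levels. -/
theorem CoadmissiblePresentation.span_range_proj (S : CoadmissiblePresentation p E d M) (i : ℕ) :
    Submodule.span (HALevel p E d i) (Set.range (S.proj i)) = ⊤ := by
  have := completeSpace_of_finite p E
  have := S.finite
  choose k q hq using fun i => Module.Finite.exists_fin' (HALevel p E d i) (S.level i)
  have hcl : ∀ i, IsClosed (LinearMap.ker (q i) : Set (Fin (k i) → HALevel p E d i)) :=
    fun i => isClosed_submodule ℚ_[p] _
  -- The levels carry no topology of their own. They are replaced by quotients of finite free
  -- modules, normed and complete because the kernels are closed.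
  let e := fun i => (q i).quotKerEquivOfSurjective (hq i)
  let f := fun i => ((e i).symm.toLinearMap.comp (S.trans i)).comp (e (i + 1)).toLinearMap
  have hdense : ∀ i, DenseRange (f i) := fun i => by
    refine denseRange_of_span_eq_top (denseRange_restrict p E d i) (f i) ?_
    have h1 : Set.range (f i) = (e i).symm '' Set.range (S.trans i) := by
      rw [← Set.range_comp]
      ext y
      constructor
      · rintro ⟨x, rfl⟩; exact ⟨e (i + 1) x, rfl⟩
      · rintro ⟨x, rfl⟩
        refine ⟨(e (i + 1)).symm x, ?_⟩
        change (e i).symm (S.trans i (e (i + 1) ((e (i + 1)).symm x))) = _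
        rw [LinearEquiv.apply_symm_apply]
        rfl
    have h2 := Submodule.map_span (e i).symm.toLinearMap (Set.range (S.trans i))
    rw [(S.isBaseChange i).span_range, Submodule.map_top, LinearEquiv.range] at h2
    rw [h1]
    exact h2.symm
  set L := (Submodule.span (HALevel p E d i) (Set.range (S.proj i))).comap (e i).toLinearMap
    with hL
  have hLcl : IsClosed (L : Set ((Fin (k i) → HALevel p E d i) ⧸ LinearMap.ker (q i))) :=
    isClosed_submodule ℚ_[p] _
  have hLtop : ∀ x, x ∈ L := by
    intro x
    rw [← SetLike.mem_coe, ← hLcl.closure_eq, Metric.mem_closure_iff]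
    intro ε hε
    -- A compatible family is an element of `M`, so `L` is dense; being closed, it is everything.
    obtain ⟨z, hz, hzx⟩ := exists_compatible_near
      (X := fun i => (Fin (k i) → HALevel p E d i) ⧸ LinearMap.ker (q i))
      (f := fun i => (f i).toAddMonoidHom)
      (fun i => continuous_of_quotient (continuous_restrict p E d i) _ (f i)) hdense i x
      (half_pos hε)
    refine ⟨z i, ?_, ?_⟩
    · obtain ⟨m, hm, -⟩ := S.isLimit (fun i => e i (z i)) fun i => by
        have h1 : (e i).symm (S.trans i (e (i + 1) (z (i + 1)))) = z i := hz i
        rw [← h1, LinearEquiv.apply_symm_apply]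
      exact Submodule.subset_span ⟨m, hm i⟩
    · rw [dist_comm, dist_eq_norm]
      exact hzx.trans_lt (half_lt_self hε)
  refine eq_top_iff.mpr fun y _ => ?_
  have h1 := hLtop ((e i).symm y)
  rw [hL, Submodule.mem_comap] at h1
  simpa using h1

omit [NormedAlgebra ℚ_[p] E] [FiniteDimensional ℚ_[p] E] in
/-- A compatible family of vectors over the `ℋ_{A,i}` comes from a vector over `ℋ_A`. -/
lemma exists_mapVec_eq {n : ℕ} (z : ∀ i, Fin n → HALevel p E d i)
    (hz : ∀ i, mapVec (HALevel.restrict p E d i) n (z (i + 1)) = z i) :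
    ∃ x : Fin n → HA p E d, ∀ i, mapVec (HA.restrict p E d i) n x = z i := by
  have h : ∀ i a, (z i a).1 = (z 0 a).1 := by
    intro i a
    induction i with
    | zero => rfl
    | succ i ih => rw [← ih, ← hz i, mapVec_apply, HALevel.coe_restrict]
  refine ⟨fun a => ⟨(z 0 a).1, Subring.mem_iInf.mpr fun i => h i a ▸ (z i a).2⟩, fun i => ?_⟩
  funext a
  refine Subtype.ext ?_
  rw [mapVec_apply, HA.coe_restrict, h i a]

/-- The levels of a coadmissible module which is the cokernel of a square matrix over `ℋ_A` are
the cokernels of the matrix over the `ℋ_{A,i}`. -/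
theorem CoadmissiblePresentation.nonempty_level_equiv (S : CoadmissiblePresentation p E d M)
    {n : ℕ} (B : Matrix (Fin n) (Fin n) (HA p E d)) (π : (Fin n → HA p E d) →ₗ[HA p E d] M)
    (hπ : Function.Surjective π) (hker : LinearMap.ker π = LinearMap.range B.mulVecLin) (i : ℕ) :
    Nonempty (((Fin n → HALevel p E d i) ⧸
      LinearMap.range (B.map (HA.restrict p E d i)).mulVecLin) ≃ₗ[HALevel p E d i] S.level i) := by
  have := completeSpace_of_finite p E
  let θ := fun i => Fintype.linearCombination (HALevel p E d i)
    fun a => S.proj i (π (Pi.single a 1))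
  have hθ : ∀ i x, θ i (mapVec (HA.restrict p E d i) n x) = S.proj i (π x) := by
    intro i x
    have hx : x = ∑ a, x a • (Pi.single a 1 : Fin n → HA p E d) := by
      simpa using ((Pi.basisFun (HA p E d) (Fin n)).sum_repr x).symm
    conv_rhs => rw [hx]
    simp only [θ, Fintype.linearCombination_apply, map_sum, map_smul, map_smulₛₗ, mapVec_apply]
  have hθt : ∀ i y, θ i (mapVec (HALevel.restrict p E d i) n y) = S.trans i (θ (i + 1) y) := by
    intro i y
    simp only [θ, Fintype.linearCombination_apply, map_sum, map_smulₛₗ, mapVec_apply, S.trans_proj]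
  have hsurj : ∀ i, Function.Surjective (θ i) := by
    intro i
    rw [← LinearMap.range_eq_top, eq_top_iff, ← S.span_range_proj i, Submodule.span_le]
    rintro _ ⟨m, rfl⟩
    obtain ⟨x, rfl⟩ := hπ m
    exact ⟨_, hθ i x⟩
  have hcl : ∀ i, IsClosed (LinearMap.ker (θ i) : Set (Fin n → HALevel p E d i)) :=
    fun i => isClosed_submodule ℚ_[p] _
  have : ∀ i, CompleteSpace (LinearMap.ker (θ i)) := fun i => (hcl i).completeSpace_coe
  let f : ∀ i, LinearMap.ker (θ (i + 1)) →ₛₗ[HALevel.restrict p E d i] LinearMap.ker (θ i) :=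
    fun i =>
      { toFun := fun y => ⟨mapVec (HALevel.restrict p E d i) n y.1, by
          rw [LinearMap.mem_ker, hθt, LinearMap.mem_ker.mp y.2, map_zero]⟩
        map_add' := fun x y => Subtype.ext (map_add (mapVec _ n) x.1 y.1)
        map_smul' := fun r y => Subtype.ext (map_smulₛₗ (mapVec _ n) r y.1) }
  have hbdd : ∀ i, IsBoundedSMul (HALevel p E d i) (LinearMap.ker (θ i)) := fun i =>
    IsBoundedSMul.of_norm_smul_le fun r x => norm_smul_le r x.1
  -- Base change makes the kernel at level `i` generated by the image of the kernel at level `i +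
  -- 1`; density of `ℋ_{A,i+1}` in `ℋ_{A,i}` does the rest.
  have hdense : ∀ i, DenseRange (f i) := fun i => by
    refine denseRange_of_span_eq_top (denseRange_restrict p E d i) (f i) ?_
    have h1 := (S.isBaseChange i).ker_le_span (hsurj (i + 1)) (hθt i)
    refine Submodule.map_injective_of_injective (LinearMap.ker (θ i)).injective_subtype ?_
    rw [Submodule.map_span, Submodule.map_top, Submodule.range_subtype]
    refine le_antisymm (Submodule.span_le.mpr ?_) (h1.trans (Submodule.span_mono ?_))
    · rintro _ ⟨y, -, rfl⟩
      exact y.2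
    · rintro _ ⟨y, hy, rfl⟩
      exact ⟨_, ⟨⟨y, hy⟩, rfl⟩, rfl⟩
  have hcont : ∀ i, Continuous (f i) := fun i =>
    ((continuous_mapVec (continuous_restrict p E d i) n).comp continuous_subtype_val).subtype_mk _
  set C := B.map (HA.restrict p E d i)
  have hC : IsClosed (LinearMap.range C.mulVecLin : Set (Fin n → HALevel p E d i)) :=
    isClosed_submodule ℚ_[p] _
  have hkerθ : LinearMap.ker (θ i) = LinearMap.range C.mulVecLin := by
    refine le_antisymm (fun y hy => ?_) ?_
    · rw [← SetLike.mem_coe, ← hC.closure_eq, Metric.mem_closure_iff]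
      intro ε hε
      obtain ⟨z, hz, hzy⟩ := exists_compatible_near (X := fun i => LinearMap.ker (θ i))
        (f := fun i => (f i).toAddMonoidHom) hcont hdense i ⟨y, hy⟩ (half_pos hε)
      obtain ⟨x, hx⟩ := exists_mapVec_eq (fun i => (z i).1) fun i => congrArg Subtype.val (hz i)
      -- All projections of `π x` vanish, so uniqueness in the limit property forces `π x = 0`, and
      -- exactness puts `x` in the range of `B`.
      have hx0 : π x = 0 := by
        obtain ⟨m, -, hm⟩ := S.isLimit 0 fun i => map_zero _
        refine (hm _ fun j => ?_).trans (hm 0 fun j => map_zero _).symm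
        rw [← hθ, hx]
        exact (z j).2
      have hx1 : x ∈ LinearMap.range B.mulVecLin := hker ▸ hx0
      obtain ⟨w, hw⟩ := hx1
      refine ⟨(z i).1, ⟨mapVec (HA.restrict p E d i) n w, ?_⟩, ?_⟩
      · rw [← hx, ← hw]
        exact (mapVec_mulVec _ B w).symm
      · rw [dist_comm, dist_eq_norm]
        exact hzy.trans_lt (half_lt_self hε)
    · rw [Matrix.range_mulVecLin, Submodule.span_le]
      rintro _ ⟨b, rfl⟩
      have h1 : C.col b = mapVec (HA.restrict p E d i) n (B.mulVec (Pi.single b 1)) := by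
        rw [Matrix.mulVec_single_one]
        rfl
      have h2 : B.mulVec (Pi.single b 1) ∈ LinearMap.ker π := hker ▸ ⟨_, rfl⟩
      rw [SetLike.mem_coe, LinearMap.mem_ker, h1, hθ, LinearMap.mem_ker.mp h2, map_zero]
  exact ⟨(Submodule.quotEquivOfEq _ _ hkerθ.symm).trans
    ((θ i).quotKerEquivOfSurjective (hsurj i))⟩

end Levels

end CylChar

/-! ### The determinant ideal in terms of bases -/

namespace CylChar

/-- Top-degree alternating forms are multiples of the determinant of a basis, so on a pure wedge the
pairing is a multiple of the determinant of `φ`. The forms `b₀.det` and the wedge of `b₁` attain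
that determinant itself. -/
lemma determinantIdeal_eq_span_det {R : Type*} [CommRing R] {P₁ P₀ : Type*}
    [AddCommGroup P₁] [Module R P₁] [AddCommGroup P₀] [Module R P₀] (φ : P₁ →ₗ[R] P₀)
    (b₁ : Module.Basis (Fin (Module.finrank R P₀)) R P₁)
    (b₀ : Module.Basis (Fin (Module.finrank R P₀)) R P₀) :
    determinantIdeal φ = Ideal.span {(LinearMap.toMatrix b₁ b₀ φ).det} := by
  have hdet : b₀.det (φ ∘ b₁) = (LinearMap.toMatrix b₁ b₀ φ).det := by
    rw [Module.Basis.det_apply]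
    congr 1
    ext i j
    rw [LinearMap.toMatrix_apply, Module.Basis.toMatrix_apply, Function.comp_apply]
  refine le_antisymm (Ideal.span_le.mpr ?_) ?_
  · rintro _ ⟨l, w, rfl⟩
    have hw : w ∈ Submodule.span R (Set.range (exteriorPower.ιMulti R (Module.finrank R P₀))) := by
      rw [exteriorPower.ιMulti_span]
      trivial
    induction hw using Submodule.span_induction with
    | mem x hx =>
      obtain ⟨m, rfl⟩ := hx
      rw [exteriorPower.map_apply_ιMulti]
      have h1 := (exteriorPower.alternatingMapLinearEquiv.symm l).eq_smul_basis_det b₀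
      have h2 := (b₀.det.compLinearMap φ).eq_smul_basis_det b₁
      have h3 := DFunLike.congr_fun h1 (φ ∘ m)
      have h4 : b₀.det (φ ∘ m) = b₀.det (φ ∘ b₁) * b₁.det m := DFunLike.congr_fun h2 m
      have h5 : l (exteriorPower.ιMulti R _ (φ ∘ m)) =
          exteriorPower.alternatingMapLinearEquiv.symm l b₀ * b₀.det (φ ∘ m) := by
        rw [← smul_eq_mul, ← AlternatingMap.smul_apply, ← h3]
        simp
      rw [h5, h4, hdet]
      exact Ideal.mul_mem_left _ _ (Ideal.mul_mem_right _ _ (Ideal.mem_span_singleton_self _))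
    | zero => rw [map_zero, map_zero]; exact zero_mem _
    | add x y _ _ hx hy => rw [map_add, map_add]; exact add_mem hx hy
    | smul a x _ hx => rw [map_smul, map_smul]; exact Ideal.mul_mem_left _ a hx
  · rw [Ideal.span_singleton_le_iff_mem]
    refine Ideal.subset_span ⟨exteriorPower.alternatingMapLinearEquiv b₀.det,
      exteriorPower.ιMulti R _ b₁, ?_⟩
    rw [exteriorPower.map_apply_ιMulti, exteriorPower.alternatingMapLinearEquiv_apply_ιMulti, hdet]

/-- The rank of the source and the target of an injective map with torsion cokernel agree. -/
lemma finrank_eq_of_isTorsion {R : Type*} [CommRing R] [IsDomain R] {M P₁ P₀ : Type*}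
    [AddCommGroup M] [Module R M] [AddCommGroup P₁] [Module R P₁] [AddCommGroup P₀] [Module R P₀]
    (htors : Module.IsTorsion R M) {φ : P₁ →ₗ[R] P₀} {π : P₀ →ₗ[R] M}
    (hφ : Function.Injective φ) (hexact : Function.Exact φ π) (hπ : Function.Surjective π) :
    Module.finrank R P₁ = Module.finrank R P₀ := by
  have h1 := rank_quotient_add_rank_of_isDomain (LinearMap.ker π)
  have h2 : Module.rank R (P₀ ⧸ LinearMap.ker π) = 0 := by
    rw [Module.rank_eq_zero_iff_isTorsion]
    intro x
    let e := π.quotKerEquivOfSurjective hπ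
    obtain ⟨a, ha⟩ := htors (x := e x)
    refine ⟨a, e.injective ?_⟩
    rw [map_zero, ← ha]
    exact e.map_smul (a : R) x
  rw [h2, zero_add, LinearMap.exact_iff.mp hexact] at h1
  rw [← LinearMap.finrank_range_of_inj hφ, Module.finrank, h1, Module.finrank]

lemma ker_comp_equivFun_symm {R : Type*} [CommRing R] {n : ℕ} {M P₁ P₀ : Type*}
    [AddCommGroup M] [Module R M] [AddCommGroup P₁] [Module R P₁] [AddCommGroup P₀] [Module R P₀]
    {φ : P₁ →ₗ[R] P₀} {π : P₀ →ₗ[R] M} (hexact : Function.Exact φ π)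
    (b₁ : Module.Basis (Fin n) R P₁) (b₀ : Module.Basis (Fin n) R P₀) :
    LinearMap.ker (π ∘ₗ b₀.equivFun.symm.toLinearMap) =
      LinearMap.range (LinearMap.toMatrix b₁ b₀ φ).mulVecLin := by
  ext x
  rw [LinearMap.mem_ker, LinearMap.comp_apply, LinearEquiv.coe_coe]
  refine (hexact _).trans ⟨?_, ?_⟩
  · rintro ⟨y, hy⟩
    refine ⟨b₁.repr y, ?_⟩
    rw [Matrix.mulVecLin_apply, LinearMap.toMatrix_mulVec_repr, hy]
    exact b₀.equivFun.apply_symm_apply x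
  · rintro ⟨v, rfl⟩
    refine ⟨b₁.equivFun.symm v, ?_⟩
    rw [LinearEquiv.eq_symm_apply, Matrix.mulVecLin_apply]
    have h := LinearMap.toMatrix_mulVec_repr b₁ b₀ φ (b₁.equivFun.symm v)
    rw [← Module.Basis.equivFun_apply, ← Module.Basis.equivFun_apply,
      LinearEquiv.apply_symm_apply] at h
    exact h.symm

lemma det_toMatrix_ne_zero {R : Type*} [CommRing R] [IsDomain R] {n : ℕ} {P₁ P₀ : Type*}
    [AddCommGroup P₁] [Module R P₁] [AddCommGroup P₀] [Module R P₀]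
    {φ : P₁ →ₗ[R] P₀} (hφ : Function.Injective φ)
    (b₁ : Module.Basis (Fin n) R P₁) (b₀ : Module.Basis (Fin n) R P₀) :
    (LinearMap.toMatrix b₁ b₀ φ).det ≠ 0 := by
  intro h
  obtain ⟨v, hv, hv0⟩ := Matrix.exists_mulVec_eq_zero_iff.mpr h
  have h1 := LinearMap.toMatrix_mulVec_repr b₁ b₀ φ (b₁.equivFun.symm v)
  rw [← Module.Basis.equivFun_apply, ← Module.Basis.equivFun_apply,
    LinearEquiv.apply_symm_apply, hv0] at h1
  have h2 : b₁.equivFun.symm v = 0 := hφ (by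
    rw [map_zero]
    exact b₀.equivFun.injective (h1.symm.trans (map_zero _).symm))
  exact hv (b₁.equivFun.symm.injective (h2.trans (map_zero _).symm))

/-! ### Principal ideals of the distribution algebra -/

section Principal

variable {p : ℕ} {E : Type*} [NormedField E] [IsUltrametricDist E] {d : ℕ}

instance : IsDomain (HA p E d) :=
  have : NoZeroDivisors (MvPowerSeries (Fin (d + 1)) E) := inferInstance
  have : IsDomain (MvPowerSeries (Fin (d + 1)) E) := NoZeroDivisors.to_isDomain _
  inferInstance

lemma HA.restrict_injective (i : ℕ) : Function.Injective (HA.restrict p E d i) := fun x y h =>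
  Subtype.ext (by rw [← HA.coe_restrict (i := i) x, h, HA.coe_restrict])

/-- An element of `ℋ_A` which is divisible by `x ≠ 0` in all the `ℋ_{A,i}` is divisible by `x`. -/
lemma iInf_comap_span_restrict {x : HA p E d} (hx : x ≠ 0) :
    ⨅ i, (Ideal.span {HA.restrict p E d i x}).comap (HA.restrict p E d i) = Ideal.span {x} := by
  refine le_antisymm (fun y hy => ?_) ?_
  · have h : ∀ i, ∃ z : HALevel p E d i, HA.restrict p E d i y = HA.restrict p E d i x * z :=
      fun i => Ideal.mem_span_singleton.mp (Ideal.mem_comap.mp (Ideal.mem_iInf.mp hy i))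
    choose z hz using h
    have hz' : ∀ i, (y : MvPowerSeries (Fin (d + 1)) E) = x * z i := fun i => by
      have h1 := congrArg Subtype.val (hz i)
      rwa [Subring.coe_mul, HA.coe_restrict, HA.coe_restrict] at h1
    have hx' : (x : MvPowerSeries (Fin (d + 1)) E) ≠ 0 := fun h => hx (Subtype.ext h)
    -- Cancelling `x` in the domain of formal series shows that all the quotients are one series,
    -- which therefore converges at every level.
    have heq : ∀ i, (z i : MvPowerSeries (Fin (d + 1)) E) = z 0 := fun i =>
      mul_left_cancel₀ hx' ((hz' i).symm.trans (hz' 0))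
    rw [Ideal.mem_span_singleton]
    exact ⟨⟨z 0, Subring.mem_iInf.mpr fun i => heq i ▸ (z i).2⟩, Subtype.ext (hz' 0)⟩
  · rw [Ideal.span_singleton_le_iff_mem, Ideal.mem_iInf]
    exact fun i => Ideal.mem_comap.mpr (Ideal.mem_span_singleton_self _)

end Principal

end CylChar

end

theorem mainTheorem11 (p : ℕ) [Fact p.Prime]
    (E : Type*) [NormedField E] [IsUltrametricDist E] [NormedAlgebra ℚ_[p] E]
    [FiniteDimensional ℚ_[p] E] (d : ℕ)
    (M : Type*) [AddCommGroup M] [Module (CylChar.HA p E d) M]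
    (htors : Module.IsTorsion (CylChar.HA p E d) M)
    (S : CylChar.CoadmissiblePresentation p E d M)
    (P₁ P₀ : Type*) [AddCommGroup P₁] [Module (CylChar.HA p E d) P₁]
    [AddCommGroup P₀] [Module (CylChar.HA p E d) P₀]
    [Module.Free (CylChar.HA p E d) P₁] [Module.Finite (CylChar.HA p E d) P₁]
    [Module.Free (CylChar.HA p E d) P₀] [Module.Finite (CylChar.HA p E d) P₀]
    (φ : P₁ →ₗ[CylChar.HA p E d] P₀) (π : P₀ →ₗ[CylChar.HA p E d] M)
    (hφ : Function.Injective φ) (hexact : Function.Exact φ π) (hπ : Function.Surjective π) :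
    Module.finrank (CylChar.HA p E d) P₁ = Module.finrank (CylChar.HA p E d) P₀ ∧
      CylChar.determinantIdeal φ = S.charIdeal := by
  have hrank := CylChar.finrank_eq_of_isTorsion htors hφ hexact hπ
  refine ⟨hrank, ?_⟩
  let b₀ := Module.finBasis (CylChar.HA p E d) P₀
  let b₁ := Module.finBasisOfFinrankEq (CylChar.HA p E d) P₁ hrank
  set B := LinearMap.toMatrix b₁ b₀ φ with hB
  have hdet : B.det ≠ 0 := CylChar.det_toMatrix_ne_zero hφ b₁ b₀
  -- Both ideals are now intersections over the levels, and the comparison reduces to the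
  -- characteristic ideal of a matrix cokernel over each `ℋ_{A,i}`.
  rw [CylChar.determinantIdeal_eq_span_det φ b₁ b₀, ← CylChar.iInf_comap_span_restrict hdet]
  refine iInf_congr fun i => congrArg (Ideal.comap (CylChar.HA.restrict p E d i)) ?_
  obtain ⟨e⟩ := S.nonempty_level_equiv B (π ∘ₗ b₀.equivFun.symm.toLinearMap)
    (hπ.comp b₀.equivFun.symm.surjective) (CylChar.ker_comp_equivFun_symm hexact b₁ b₀) i
  have hdet' : (B.map (CylChar.HA.restrict p E d i)).det = CylChar.HA.restrict p E d i B.det :=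
    (RingHom.map_det (CylChar.HA.restrict p E d i) B).symm
  rw [← CylChar.charIdeal_congr e, CylChar.charIdeal_quotient_range _ (by
    rw [hdet']
    exact fun h => hdet (CylChar.HA.restrict_injective i (h.trans (map_zero _).symm))), hdet']
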